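/- **Setting.** Let $\mathcal H_1\subset\mathcal H_\alpha\subset\mathcal H$ with $\mathcal H_1,\mathcal H$ real Hilbert spaces, $\mathcal H_1$ compactly and densely embedded in $\mathcal H$, and $\mathcal H_\alpha$ a normed space, continuously embedded in $\mathcal H$ and containing $\mathcal H_1$ with continuous inclusion (e.g. an interpolation space). For a fixed parameter $\lambda$ let $L_\lambda=-A+B_\lambda$ with bounded linear $A:\mathcal H_1\to\mathcal H$ (e.g. a sectorial operator) and $B_\lambda:\mathcal H_\alpha\to\mathcal H$. Assume that $L_\lambda$, as an unbounded operator in $\mathcal H$ with domain $\mathcal H_1$, is self-adjoint, and that $\mathcal H$ has an orthonormal basis $(e_k)_{k\ge1}$ of eigenvectors $e_k\in\mathcal H_1$, $L_\lambda e_k=\beta_k(\lambda)e_k$. Write $\beta_k=\beta_k(\lambda)$. Let $B:\mathcal H_\alpha\times\mathcal H_\alpha\to\mathcal H$ be continuous and bilinear, and $B(u):=B(u,u)$. Let $\Omega=C_0(\mathbb R,\mathbb R^N)$ be the space of continuous paths vanishing at $0$, with the topology of locally uniform convergence, its Borel $\sigma$-algebra, the two-sided Wiener measure $\mathbb P$ and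 the shifts $\theta_t\omega=\omega(\cdot+t)-\omega(t)$. Let $W_t(\omega)=\sum_{i=1}^N\sigma_iW^i_t(\omega)e_i$, where $W^i_t(\omega)=\omega_i(t)$ and $\sigma_i>0$ for $i\le N$; put $\sigma_i=0$ and $W^i=0$ for $i>N$. This is the setting of the SPDE $du=(L_\lambda u+B(u))\,dt+dW_t$. Fix $m\ge 0$, $\mathcal H^{\mathfrak c}=\mathrm{span}\{e_1,\dots,e_m\}$, $P_{\mathfrak c}x=\sum_{k\le m}\langle x,e_k\rangle e_k$, $P_{\mathfrak s}=\mathrm{Id}-P_{\mathfrak c}$, $\mathcal H^{\mathfrak s}=P_{\mathfrak s}\mathcal H$, $L^{\mathfrak c}_\lambda=P_{\mathfrak c}L_\lambda$, $L^{\mathfrak s}_\lambda=P_{\mathfrak s}L_\lambda$. For $\xi\in\mathcal H^{\mathfrak c}$, $T>0$ and $\omega\in\Omega$ consider the backward-forward system $$du_{\mathfrak c}=L^{\mathfrak c}_\lambda u_{\mathfrak c}\,ds+dP_{\mathfrak c}W_s(\omega),\quad s\in[-T,0],\quad u_{\mathfrak c}(0)=\xi,\tag{1}$$ $$du_{\mathfrak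 s}=\big(L^{\mathfrak s}_\lambda u_{\mathfrak s}+P_{\mathfrak s}B(u_{\mathfrak c}(s-T))\big)ds+dP_{\mathfrak s}W_{s-T}(\omega),\quad s\in[0,T],\quad u_{\mathfrak s}(0)=0,\tag{2}$$ understood pathwise: (1) as an integral equation for continuous $u_{\mathfrak c}:[-T,0]\to\mathcal H^{\mathfrak c}$, and (2) in the weak sense (integrated in time and tested against all vectors of $\mathcal H_1$) for continuous $u_{\mathfrak s}:[0,T]\to\mathcal H^{\mathfrak s}$. The noise in (2) is the path $s\mapsto W_s(\theta_{-T}\omega)=W_{s-T}(\omega)-W_{-T}(\omega)$, and the value at $s=T$ of the solution is written $u_{\mathfrak s}[\xi](T,\theta_{-T}\omega;0)$. **Theorem.** Assume that $\beta_n<0$ for all $n>m$ and that, for all $i_1,i_2\in\{1,\dots,m\}$ and $n>m$ with $\langle B(e_{i_1},e_{i_2}),e_n\rangle\ne0$, $$\beta_{i_1}+\beta_{i_2}-\beta_n>0;\qquad \sigma_{i_1}\ne0\Rightarrow\beta_{i_2}-\beta_n>0;\qquad \sigma_{i_2}\ne0\Rightarrow\beta_{i_1}-\beta_n>0.\tag{NR}$$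 Let $\Omega_*=\{\omega\in\Omega:\ \omega(t)/t\to0 \text{ as } t\to\pm\infty\}$. Then $\mathbb P(\Omega_*)=1$, $\theta_t^{-1}\Omega_*=\Omega_*$ for all $t\in\mathbb R$, and for all $\omega\in\Omega_*$, $\xi\in\mathcal H^{\mathfrak c}$: 1. For each $T>0$, (1) and (2) are uniquely solvable, and the solution of (1) is $$u_{\mathfrak c}(s,\omega;\xi)=e^{sL^{\mathfrak c}_\lambda}\xi+P_{\mathfrak c}W_s(\omega)-\int_s^0e^{(s-\tau)L^{\mathfrak c}_\lambda}L^{\mathfrak c}_\lambda P_{\mathfrak c}W_\tau(\omega)\,d\tau .$$ 2. The pullback limit exists in $\mathcal H$ and $$h^{(1)}_\lambda(\xi,\omega)=\lim_{T\to\infty}u_{\mathfrak s}[\xi](T,\theta_{-T}\omega;0)=\int_{-\infty}^0e^{-\tau L^{\mathfrak s}_\lambda}L^{\mathfrak s}_\lambda P_{\mathfrak s}W_\tau(\omega)\,d\tau+\int_{-\infty}^0e^{-\tau L^{\mathfrak s}_\lambda}P_{\mathfrak s}B(u_{\mathfrak c}(\tau,\omega;\xi))\,d\tau,$$ where both integrals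 converge absolutely in $\mathcal H$. 3. With $\xi_i=\langle\xi,e_i\rangle$ and a series converging in $\mathcal H$, $$h^{(1)}_\lambda(\xi,\omega)=\sum_{n=m+1}^{N}Z_n(\omega)e_n+\sum_{n=m+1}^\infty\sum_{i_1,i_2=1}^m\Big(A^{n,i_1,i_2}+B^{n,i_1,i_2}\xi_{i_1}+C^{n,i_1,i_2}\xi_{i_2}+D^{n,i_1,i_2}\xi_{i_1}\xi_{i_2}\Big)\langle B(e_{i_1},e_{i_2}),e_n\rangle e_n ,$$ (only the terms with $\langle B(e_{i_1},e_{i_2}),e_n\rangle\ne0$ being present), where $Z_n=\sigma_n\beta_n\int_{-\infty}^0e^{-\tau\beta_n}W^n_\tau\,d\tau$, $A=M_1+M_2+M_3+M_4$, $B=M_5+M_6$, $C=M_7+M_8$, $$D^{n,i_1,i_2}=\int_{-\infty}^0e^{(\beta_{i_1}+\beta_{i_2}-\beta_n)\tau}d\tau=\frac1{\beta_{i_1}+\beta_{i_2}-\beta_n},$$ and, with $J^i_\tau=\int_\tau^0e^{(\tau-\tau')\beta_i}W^i_{\tau'}\,d\tau'$, $$\begin{aligned} M_1&=\sigma_{i_1}\sigma_{i_2}\int_{-\infty}^0e^{-\beta_n\tau}W^{i_1}_\tau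 W^{i_2}_\tau d\tau, & M_2&=-\sigma_{i_1}\sigma_{i_2}\beta_{i_2}\int_{-\infty}^0e^{-\beta_n\tau}W^{i_1}_\tau J^{i_2}_\tau d\tau,\\ M_3&=-\sigma_{i_1}\sigma_{i_2}\beta_{i_1}\int_{-\infty}^0e^{-\beta_n\tau}W^{i_2}_\tau J^{i_1}_\tau d\tau, & M_4&=\sigma_{i_1}\sigma_{i_2}\beta_{i_1}\beta_{i_2}\int_{-\infty}^0e^{-\beta_n\tau}J^{i_1}_\tau J^{i_2}_\tau d\tau,\\ M_5&=\sigma_{i_2}\int_{-\infty}^0e^{(\beta_{i_1}-\beta_n)\tau}W^{i_2}_\tau d\tau, & M_6&=-\sigma_{i_2}\beta_{i_2}\int_{-\infty}^0e^{(\beta_{i_1}-\beta_n)\tau}J^{i_2}_\tau d\tau,\\ M_7&=\sigma_{i_1}\int_{-\infty}^0e^{(\beta_{i_2}-\beta_n)\tau}W^{i_1}_\tau d\tau, & M_8&=-\sigma_{i_1}\beta_{i_1}\int_{-\infty}^0e^{(\beta_{i_2}-\beta_n)\tau}J^{i_1}_\tau d\tau . \end{aligned}$$ The integrals defining $Z_n$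 ($m<n\le N$) converge absolutely, and so do those defining $D$ and the $M_j$ whenever $\langle B(e_{i_1},e_{i_2}),e_n\rangle\ne0$. -/

import Mathlib

open MeasureTheory ProbabilityTheory Set Filter Topology
open scoped NNReal

noncomputable section

namespace BackwardForward

/-! ### The canonical space of the two-sided `ℝ^N`-valued Wiener process -/

/-- The path space `Ω = C₀(ℝ, ℝ^N)` of continuous paths vanishing at time `0`. -/
def PathSpace (N : ℕ) : Type := {ω : C(ℝ, Fin N → ℝ) // ω 0 = 0}

/-- The compact-open topology (locally uniform convergence). -/
instance (N : ℕ) : TopologicalSpace (PathSpace N) :=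
  inferInstanceAs (TopologicalSpace {ω : C(ℝ, Fin N → ℝ) // ω 0 = 0})

instance (N : ℕ) : MeasurableSpace (PathSpace N) := borel _

instance (N : ℕ) : BorelSpace (PathSpace N) := ⟨rfl⟩

/-- The path `W^i_t(ω)`; by convention `W^i = 0` for the modes `i ≥ N`, which are not forced. -/
def PathSpace.coord {N : ℕ} (ω : PathSpace N) (i : ℕ) (t : ℝ) : ℝ :=
  if h : i < N then ω.1 t ⟨i, h⟩ else 0

/-- The Wiener shift `(θ_t ω)(s) = ω(s + t) - ω(t)`. -/
def shift {N : ℕ} (t : ℝ) (ω : PathSpace N) : PathSpace N :=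
  ⟨⟨fun s => ω.1 (s + t) - ω.1 t, by fun_prop⟩, by simp⟩

/-- `W_s(θ_{-T} ω) = W_{s-T}(ω) - W_{-T}(ω)`. -/
theorem coord_shift_neg {N : ℕ} (T : ℝ) (ω : PathSpace N) (i : ℕ) (s : ℝ) :
    (shift (-T) ω).coord i s = ω.coord i (s - T) - ω.coord i (-T) := by
  by_cases h : i < N
  · simp [PathSpace.coord, h, shift, sub_eq_add_neg]
  · simp [PathSpace.coord, h]

/-- `P` is the (two-sided) Wiener measure: under `P` the `2 N` processes
`(W^i_t)_{t ≥ 0}` and `(W^i_{-t})_{t ≥ 0}` are mutually independent standard Brownian motions.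
(Continuity of the paths is built into the path space.) -/
structure IsWienerMeasure {N : ℕ} (P : Measure (PathSpace N)) : Prop where
  prob : IsProbabilityMeasure P
  brownian_fwd : ∀ i : Fin N,
    IsPreBrownianReal (fun (t : ℝ≥0) (ω : PathSpace N) => ω.coord i (t : ℝ)) P
  brownian_bwd : ∀ i : Fin N,
    IsPreBrownianReal (fun (t : ℝ≥0) (ω : PathSpace N) => ω.coord i (-(t : ℝ))) P
  indep : iIndepFun
    (fun (p : Fin N × Bool) (ω : PathSpace N) (t : ℝ≥0) =>
      ω.coord p.1 (if p.2 then (t : ℝ) else -(t : ℝ))) P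

/-- The paths of sublinear growth: `ω(t) / t → 0` as `t → ±∞`. -/
def sublinearPaths (N : ℕ) : Set (PathSpace N) :=
  {ω | Tendsto (fun t : ℝ => t⁻¹ • ω.1 t) atTop (𝓝 0) ∧
       Tendsto (fun t : ℝ => t⁻¹ • ω.1 t) atBot (𝓝 0)}

/-! ### The functional framework -/

/-- The unbounded operator in `H` with domain `ι(H₁)` that is given by `L : H₁ → H`. -/
def unboundedOp {H H₁ : Type*} [NormedAddCommGroup H] [InnerProductSpace ℝ H]
    [NormedAddCommGroup H₁] [InnerProductSpace ℝ H₁]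
    (ι : H₁ →L[ℝ] H) (hι : Function.Injective ι) (L : H₁ →L[ℝ] H) : H →ₗ.[ℝ] H where
  domain := LinearMap.range (ι : H₁ →ₗ[ℝ] H)
  toFun := (L : H₁ →ₗ[ℝ] H) ∘ₗ
    ((LinearEquiv.ofInjective (ι : H₁ →ₗ[ℝ] H) hι).symm :
      LinearMap.range (ι : H₁ →ₗ[ℝ] H) →ₗ[ℝ] H₁)

/-- The data of the equation `du = (L_λ u + B(u, u)) dt + dW`, for a fixed value of `λ`:
spaces `H₁ ⊂ Hα ⊂ H`, the operator `L_λ = -A + B_λ` with domain `H₁`, self-adjoint in `H`, with an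
orthonormal basis of eigenvectors, a continuous bilinear map `B : Hα × Hα → H`, the noise
intensities and the number `m` of low modes.
`Hα` may be any normed space between `H₁` and `H`, in particular any interpolation space, and `A`
any bounded operator from `H₁` to `H`, in particular a sectorial one; when all but finitely many
eigenvalues are negative, self-adjointness of `L_λ` makes `-L_λ` sectorial.
Modes are numbered from `0`: index `k` stands for the mode `k + 1` in numbering from `1`, so that
the low modes are the `k < m`, the high modes the `k ≥ m`, and the forced modes the `k < N`. -/
structure Setting (H H₁ Hα : Type*)
    [NormedAddCommGroup H] [InnerProductSpace ℝ H] [CompleteSpace H]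
    [NormedAddCommGroup H₁] [InnerProductSpace ℝ H₁] [CompleteSpace H₁]
    [NormedAddCommGroup Hα] [NormedSpace ℝ Hα] (N : ℕ) where
  /-- the inclusion `H₁ ⊂ Hα` -/
  toAlpha : H₁ →L[ℝ] Hα
  /-- the inclusion `Hα ⊂ H` -/
  ofAlpha : Hα →L[ℝ] H
  /-- the inclusion `H₁ ⊂ H` -/
  ι : H₁ →L[ℝ] H
  ι_eq : ι = ofAlpha.comp toAlpha
  ofAlpha_injective : Function.Injective ofAlpha
  ι_injective : Function.Injective ι
  ι_compact : IsCompactOperator ι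
  ι_dense : DenseRange ι
  A : H₁ →L[ℝ] H
  /-- the perturbations `B_λ`, `λ ∈ ℝ` -/
  Blin : ℝ → (Hα →L[ℝ] H)
  /-- the parameter `λ` -/
  lam : ℝ
  selfAdjoint : IsSelfAdjoint (unboundedOp ι ι_injective (-A + (Blin lam).comp toAlpha))
  /-- the orthonormal basis of eigenvectors, as elements of `H` -/
  b : HilbertBasis ℕ ℝ H
  /-- the same eigenvectors, as elements of the domain `H₁` -/
  e : ℕ → H₁
  ι_e : ∀ k, ι (e k) = b k
  /-- the eigenvalues `β_k(λ)` -/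
  β : ℕ → ℝ
  eigen : ∀ k, (-A + (Blin lam).comp toAlpha) (e k) = β k • b k
  /-- the continuous bilinear nonlinearity -/
  B : Hα →L[ℝ] Hα →L[ℝ] H
  /-- the noise intensities, positive on the forced modes and zero on the others -/
  σ : ℕ → ℝ
  σ_pos : ∀ i, i < N → 0 < σ i
  σ_zero : ∀ i, N ≤ i → σ i = 0
  /-- the dimension of the space of low modes -/
  m : ℕ

namespace Setting

variable {H H₁ Hα : Type*}
  [NormedAddCommGroup H] [InnerProductSpace ℝ H] [CompleteSpace H]
  [NormedAddCommGroup H₁] [InnerProductSpace ℝ H₁] [CompleteSpace H₁]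
  [NormedAddCommGroup Hα] [NormedSpace ℝ Hα] {N : ℕ}
  (S : Setting H H₁ Hα N)

/-- `L_λ = -A + B_λ : H₁ → H`. -/
def L : H₁ →L[ℝ] H := -S.A + (S.Blin S.lam).comp S.toAlpha

/-- The `H`-coordinate `⟨x, e_k⟩`. -/
def coeff (k : ℕ) (x : H) : ℝ := inner ℝ (S.b k) x

/-- The space of low modes `H^c = span {e_k : k < m}`, inside the domain `H₁`. -/
def Hc : Submodule ℝ H₁ := Submodule.span ℝ (S.e '' {k | k < S.m})

/-- The projector `P_c x = ∑_{k < m} ⟨x, e_k⟩ e_k`, with values in `H^c ⊂ H₁`. -/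
def Pc (x : H) : H₁ := ∑ k ∈ Finset.range S.m, S.coeff k x • S.e k

/-- The projector `P_s x = x - P_c x` in `H`. -/
def Ps (x : H) : H := x - S.ι (S.Pc x)

/-- The projector `P_s` on the domain `H₁`. -/
def Ps₁ (x : H₁) : H₁ := x - S.Pc (S.ι x)

/-- `L^c_λ = P_c L_λ`. -/
def Lc (x : H₁) : H₁ := S.Pc (S.L x)

/-- `L^s_λ = P_s L_λ`. -/
def Ls (x : H₁) : H := S.Ps (S.L x)

/-- `B(u, u)` for `u` in the domain. -/
def Bq (u : H₁) : H := S.B (S.toAlpha u) (S.toAlpha u)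

/-- The interaction coefficient `⟨B(e_i, e_j), e_n⟩`. -/
def Bcoef (i j n : ℕ) : ℝ := S.coeff n (S.B (S.toAlpha (S.e i)) (S.toAlpha (S.e j)))

/-- `exp(t L^c_λ)` on `H^c`, for every real `t`. -/
def expLc (t : ℝ) (x : H₁) : H₁ :=
  ∑ k ∈ Finset.range S.m, (Real.exp (t * S.β k) * S.coeff k (S.ι x)) • S.e k

/-- `exp(t L^s_λ) P_s`, for `t ≥ 0` (the series converges in `H` when the `β_n`, `n ≥ m`, are
bounded above). -/
def expLs (t : ℝ) (x : H) : H :=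
  ∑' n, (if S.m ≤ n then Real.exp (t * S.β n) * S.coeff n x else 0) • S.b n

/-- The noise `W_t(ω) = ∑_{i < N} σ_i W^i_t(ω) e_i`, an element of the domain `H₁`. -/
def W (ω : PathSpace N) (t : ℝ) : H₁ :=
  ∑ i ∈ Finset.range N, (S.σ i * ω.coord i t) • S.e i

/-! ### The backward-forward system -/

/-- `u` is a solution on `[-T, 0]` of `du = L^c_λ u ds + dP_c W_s`, `u(0) = ξ`. As `W_0 = 0`, this
means `u(s) = ξ - ∫_s^0 L^c_λ u(r) dr + P_c W_s(ω)`. -/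
structure IsLowSolution (ω : PathSpace N) (ξ : H₁) (T : ℝ) (u : ℝ → H₁) : Prop where
  mem : ∀ s ∈ Icc (-T) 0, u s ∈ S.Hc
  cont : ContinuousOn u (Icc (-T) 0)
  eq : ∀ s ∈ Icc (-T) 0, u s = ξ - (∫ r in s..0, S.Lc (u r)) + S.Pc (S.ι (S.W ω s))

/-- `u` is a weak solution on `[0, T]`, with values in `H^s`, of
`du = (L^s_λ u + P_s B(u_c(s - T), u_c(s - T))) ds + dP_s W_{s-T}`, `u(0) = 0`,
the test vectors being the elements of the domain of the self-adjoint operator `L_λ`.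
The noise is written in the fiber `θ_{-T} ω`: `W_s(θ_{-T} ω) = W_{s-T}(ω) - W_{-T}(ω)`. -/
structure IsHighSolution (ω : PathSpace N) (T : ℝ) (uc : ℝ → H₁) (u : ℝ → H) : Prop where
  mem : ∀ s ∈ Icc 0 T, ∀ k < S.m, S.coeff k (u s) = 0
  cont : ContinuousOn u (Icc 0 T)
  eq : ∀ s ∈ Icc 0 T, ∀ φ : H₁,
    inner ℝ (S.ι φ) (u s) =
      (∫ r in (0 : ℝ)..s,
        (inner ℝ (S.L φ) (u r) + inner ℝ (S.ι φ) (S.Ps (S.Bq (uc (r - T)))))) +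
      inner ℝ (S.ι φ) (S.ι (S.Ps₁ (S.W (shift (-T) ω) s)))

/-- The pair `(u_c, u_s)` solves the backward-forward system of horizon `T`. -/
structure IsSolution (ω : PathSpace N) (ξ : H₁) (T : ℝ) (uc : ℝ → H₁) (us : ℝ → H) : Prop where
  low : S.IsLowSolution ω ξ T uc
  high : S.IsHighSolution ω T uc us

/-- The explicit path
`u_c(s) = exp(s L^c) ξ + P_c W_s - ∫_s^0 exp((s - τ) L^c) L^c P_c W_τ dτ`. -/
def lowPath (ω : PathSpace N) (ξ : H₁) (s : ℝ) : H₁ :=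
  S.expLc s ξ + S.Pc (S.ι (S.W ω s)) -
    ∫ τ in s..0, S.expLc (s - τ) (S.Lc (S.Pc (S.ι (S.W ω τ))))

/-- The integrand `exp(-τ L^s) L^s P_s W_τ`. -/
def noiseIntegrand (ω : PathSpace N) (τ : ℝ) : H :=
  S.expLs (-τ) (S.Ls (S.Ps₁ (S.W ω τ)))

/-- The integrand `exp(-τ L^s) P_s B(u_c(τ), u_c(τ))`. -/
def bilinIntegrand (ω : PathSpace N) (ξ : H₁) (τ : ℝ) : H :=
  S.expLs (-τ) (S.Ps (S.Bq (S.lowPath ω ξ τ)))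

/-! ### Non-resonance, and the coefficients of the expansion -/

/-- The non-resonance conditions. -/
def NonResonant : Prop :=
  (∀ i₁ < S.m, ∀ i₂ < S.m, ∀ n, S.m ≤ n → S.Bcoef i₁ i₂ n ≠ 0 →
    0 < S.β i₁ + S.β i₂ - S.β n) ∧
  (∀ i₁ < S.m, ∀ i₂ < S.m, ∀ n, S.m ≤ n → S.Bcoef i₁ i₂ n ≠ 0 → S.σ i₁ ≠ 0 →
    0 < S.β i₂ - S.β n) ∧
  (∀ i₁ < S.m, ∀ i₂ < S.m, ∀ n, S.m ≤ n → S.Bcoef i₁ i₂ n ≠ 0 → S.σ i₂ ≠ 0 →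
    0 < S.β i₁ - S.β n)

/-- `Z_n(ω) = σ_n β_n ∫_{-∞}^0 exp(-τ β_n) W^n_τ dτ`. -/
def Z (ω : PathSpace N) (n : ℕ) : ℝ :=
  S.σ n * S.β n * ∫ τ in Iic (0 : ℝ), Real.exp (-τ * S.β n) * ω.coord n τ

/-- `J^i_τ = ∫_τ^0 exp((τ - τ') β_i) W^i_{τ'} dτ'`. -/
def J (ω : PathSpace N) (i : ℕ) (τ : ℝ) : ℝ :=
  ∫ τ' in τ..0, Real.exp ((τ - τ') * S.β i) * ω.coord i τ'

/-- The integrands in `M_1, …, M_8` (`M_j` has the index `j - 1`). -/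
def Mkernel (ω : PathSpace N) (n i₁ i₂ : ℕ) (j : Fin 8) (τ : ℝ) : ℝ :=
  ![Real.exp (-S.β n * τ) * ω.coord i₁ τ * ω.coord i₂ τ,
    Real.exp (-S.β n * τ) * ω.coord i₁ τ * S.J ω i₂ τ,
    Real.exp (-S.β n * τ) * ω.coord i₂ τ * S.J ω i₁ τ,
    Real.exp (-S.β n * τ) * S.J ω i₁ τ * S.J ω i₂ τ,
    Real.exp ((S.β i₁ - S.β n) * τ) * ω.coord i₂ τ,
    Real.exp ((S.β i₁ - S.β n) * τ) * S.J ω i₂ τ,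
    Real.exp ((S.β i₂ - S.β n) * τ) * ω.coord i₁ τ,
    Real.exp ((S.β i₂ - S.β n) * τ) * S.J ω i₁ τ] j

/-- The constants in front of the integrals in `M_1, …, M_8`. -/
def Mfactor (i₁ i₂ : ℕ) : Fin 8 → ℝ :=
  ![S.σ i₁ * S.σ i₂,
    -(S.σ i₁ * S.σ i₂ * S.β i₂),
    -(S.σ i₁ * S.σ i₂ * S.β i₁),
    S.σ i₁ * S.σ i₂ * S.β i₁ * S.β i₂,
    S.σ i₂,
    -(S.σ i₂ * S.β i₂),
    S.σ i₁,
    -(S.σ i₁ * S.β i₁)]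

/-- The random coefficients `M_1, …, M_8` (`M_j` has the index `j - 1`). -/
def M (ω : PathSpace N) (n i₁ i₂ : ℕ) (j : Fin 8) : ℝ :=
  S.Mfactor i₁ i₂ j * ∫ τ in Iic (0 : ℝ), S.Mkernel ω n i₁ i₂ j τ

/-- The constant coefficient `M_1 + M_2 + M_3 + M_4`. -/
def coefA (ω : PathSpace N) (n i₁ i₂ : ℕ) : ℝ :=
  S.M ω n i₁ i₂ 0 + S.M ω n i₁ i₂ 1 + S.M ω n i₁ i₂ 2 + S.M ω n i₁ i₂ 3

/-- The coefficient `M_5 + M_6` of `ξ_{i₁}`. -/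
def coefB (ω : PathSpace N) (n i₁ i₂ : ℕ) : ℝ := S.M ω n i₁ i₂ 4 + S.M ω n i₁ i₂ 5

/-- The coefficient `M_7 + M_8` of `ξ_{i₂}`. -/
def coefC (ω : PathSpace N) (n i₁ i₂ : ℕ) : ℝ := S.M ω n i₁ i₂ 6 + S.M ω n i₁ i₂ 7

/-- The coefficient `D` of `ξ_{i₁} ξ_{i₂}`. -/
def coefD (n i₁ i₂ : ℕ) : ℝ :=
  ∫ τ in Iic (0 : ℝ), Real.exp ((S.β i₁ + S.β i₂ - S.β n) * τ)

/-- The `n`-th term of the series in the expansion of the pullback limit. -/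
def expansionTerm (ω : PathSpace N) (ξ : H₁) (n : ℕ) : H :=
  ∑ i₁ ∈ Finset.range S.m, ∑ i₂ ∈ Finset.range S.m,
    ((S.coefA ω n i₁ i₂
      + S.coefB ω n i₁ i₂ * S.coeff i₁ (S.ι ξ)
      + S.coefC ω n i₁ i₂ * S.coeff i₂ (S.ι ξ)
      + S.coefD n i₁ i₂ * S.coeff i₁ (S.ι ξ) * S.coeff i₂ (S.ι ξ)) * S.Bcoef i₁ i₂ n) • S.b n

end Setting

end BackwardForward

end

noncomputable section

namespace BackwardForward

/-! ### Sublinear growth of Brownian paths -/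

/-! Everything pathwise is diagonal in the eigenbasis. Symmetry of `L` gives `⟨Lφ, e_k⟩ = β_k ⟨φ,
e_k⟩` for all `φ` in the domain (`coeff_L`), so both equations split into scalar equations `y' = β y
+ k`, solved by a Duhamel integral once the noise has been subtracted. Uniqueness is uniqueness for
the homogeneous scalar equation (`eq_zero_of_eq_integral`).

At the terminal time the substitution `τ = r - T` turns the high-mode solution into the integral
over `[-T, 0]` of the two limit integrands, minus a remainder with coordinates `σ_n exp(T β_n)
W^n_{-T}` (`highPath_lowPath_eq`). Sublinear growth of the path kills the remainder, so the pullback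
limit exists as soon as the integrands are integrable on `(-∞, 0]`.

A low coordinate is `O((1 + |τ|)² (a + exp(τ β_i)))` with `a = 1` if mode `i` is forced and `a = 0`
otherwise (`HasGrowth`). Multiplying two such bounds by `exp(-β_n τ)` gives four exponential rates:
one is positive because `β_n < 0`, the other three by the three clauses of (NR). Integrability in
`H` needs one rate for all interacting `n` at once. It exists because the compact embedding forces
`β_n → -∞`, so that only finitely many modes can come close to the threshold (`tendsto_β`,
`exists_lt_forall_le`, `integrableOn_bilinIntegrand`). The series is then the basis expansion of the
bilinear integral.

Almost sure sublinear growth is time inversion: `t X_{1/t}` has the law of `X`, and `X` is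
continuous at `0` (`ae_tendsto_div`). -/

/-- Functions which tend to `0` at `0` along a dense sequence. -/
def smallNearZero : Set (ℝ≥0 → ℝ) :=
  {f | ∀ k : ℕ, ∃ n : ℕ, ∀ i : ℕ, 0 < TopologicalSpace.denseSeq ℝ≥0 i →
    TopologicalSpace.denseSeq ℝ≥0 i < 1 / ((n : ℝ≥0) + 1) →
    |f (TopologicalSpace.denseSeq ℝ≥0 i)| ≤ 1 / ((k : ℝ) + 1)}

/-- Only countably many times are tested, so the product σ-algebra suffices; this is what allows the
property to pass between processes with equal laws. -/
theorem measurableSet_smallNearZero : MeasurableSet smallNearZero := by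
  simp only [smallNearZero, ofPred_forall, ofPred_exists]
  refine MeasurableSet.iInter fun k => MeasurableSet.iUnion fun n => MeasurableSet.iInter fun i =>
    MeasurableSet.iInter fun _ => MeasurableSet.iInter fun _ => ?_
  exact measurableSet_le (measurable_pi_apply _).norm measurable_const

theorem mem_smallNearZero_of_continuous {f : ℝ≥0 → ℝ} (hf : Continuous f) (h0 : f 0 = 0) :
    f ∈ smallNearZero := by
  intro k
  have h1 : ∀ᶠ t in 𝓝 (0 : ℝ≥0), |f t| < 1 / ((k : ℝ) + 1) := by
    have : Tendsto (fun t => |f t|) (𝓝 0) (𝓝 0) := by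
      simpa [h0] using (hf.abs.tendsto 0)
    exact this.eventually (gt_mem_nhds (by positivity))
  obtain ⟨ε, hε, h⟩ := Metric.eventually_nhds_iff.1 h1
  obtain ⟨n, hn⟩ := exists_nat_one_div_lt hε
  refine ⟨n, fun i _ hi => (h ?_).le⟩
  rw [NNReal.dist_eq]
  have : ((TopologicalSpace.denseSeq ℝ≥0 i : ℝ≥0) : ℝ) < 1 / ((n : ℝ) + 1) := by exact_mod_cast hi
  simp only [NNReal.coe_zero, sub_zero, NNReal.abs_eq]
  linarith

/-- Continuity off `0` carries the bound from the dense times to all small positive times.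
Continuity at `0` is not available for the inverted process and must not be assumed. -/
theorem abs_le_of_mem_smallNearZero {f : ℝ≥0 → ℝ} (hf : ContinuousOn f (Ioi 0))
    (h : f ∈ smallNearZero) (k : ℕ) :
    ∃ n : ℕ, ∀ s : ℝ≥0, 0 < s → s < 1 / ((n : ℝ≥0) + 1) → |f s| ≤ 1 / ((k : ℝ) + 1) := by
  obtain ⟨n, hn⟩ := h k
  refine ⟨n, fun s hs0 hs1 => ?_⟩
  have hs : s ∈ closure (Ioo 0 (1 / ((n : ℝ≥0) + 1)) ∩ range (TopologicalSpace.denseSeq ℝ≥0)) :=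
    (TopologicalSpace.denseRange_denseSeq ℝ≥0).open_subset_closure_inter isOpen_Ioo ⟨hs0, hs1⟩
  have hc : ContinuousWithinAt (fun s => |f s|)
      (Ioo 0 (1 / ((n : ℝ≥0) + 1)) ∩ range (TopologicalSpace.denseSeq ℝ≥0)) s :=
    (hf.abs s hs0).mono fun x hx => hx.1.1
  have := hc.mem_closure (t := Iic (1 / ((k : ℝ) + 1))) hs (by
    rintro _ ⟨⟨h1, h2⟩, i, rfl⟩
    exact hn i h1 h2)
  simpa using this

/-- A Brownian motion with continuous paths grows sublinearly. -/
theorem _root_.ProbabilityTheory.IsPreBrownianReal.ae_tendsto_div {Ω : Type*} [MeasurableSpace Ω]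
    {P : Measure Ω}
    {X : ℝ≥0 → Ω → ℝ} (hX : IsPreBrownianReal X P) (hm : ∀ t, Measurable (X t))
    (hc : ∀ ω, Continuous fun t => X t ω) (h0 : ∀ ω, X 0 ω = 0) :
    ∀ᵐ ω ∂P, Tendsto (fun t : ℝ≥0 => (t : ℝ)⁻¹ * X t ω) atTop (𝓝 0) := by
  have := hX.isGaussianProcess.isProbabilityMeasure
  -- Time inversion: smallness of `Y` at time `1 / t` is smallness of `X t / t`.
  set Y : ℝ≥0 → Ω → ℝ := fun t ω => t * X (1 / t) ω with hY
  have hmX : Measurable fun ω t => X t ω := measurable_pi_lambda _ hm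
  have hmY : Measurable fun ω t => Y t ω := measurable_pi_lambda _ fun t => (hm _).const_mul _
  -- A law on the product space is determined by its finite-dimensional marginals, which are
  -- Brownian for both processes.
  have hlaw : P.map (fun ω t => X t ω) = P.map (fun ω t => Y t ω) := by
    rw [map_eq_iff_forall_finset_map_restrict_eq hmX.aemeasurable hmY.aemeasurable]
    intro I
    rw [(hX.hasLaw I).map_eq, (hX.inv.hasLaw I).map_eq]
  have hXs : ∀ᵐ f ∂(P.map (fun ω t => X t ω)), f ∈ smallNearZero := by
    rw [ae_map_iff (p := (· ∈ smallNearZero)) hmX.aemeasurable measurableSet_smallNearZero]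
    exact ae_of_all _ fun ω => mem_smallNearZero_of_continuous (hc ω) (h0 ω)
  rw [hlaw, ae_map_iff (p := (· ∈ smallNearZero)) hmY.aemeasurable
    measurableSet_smallNearZero] at hXs
  filter_upwards [hXs] with ω hω
  have hcY : ContinuousOn (fun t => Y t ω) (Ioi 0) := by
    refine ContinuousOn.mul (by fun_prop) ?_
    refine (hc ω).comp_continuousOn ?_
    refine continuousOn_const.div continuousOn_id fun x hx => (ne_of_gt hx)
  rw [Metric.tendsto_atTop]
  intro ε hε
  obtain ⟨k, hk⟩ := exists_nat_one_div_lt hε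
  obtain ⟨n, hn⟩ := abs_le_of_mem_smallNearZero hcY hω k
  -- The choice `n + 2` makes `1 / t < 1 / (n + 1)` strict.
  refine ⟨n + 2, fun t ht => ?_⟩
  have ht0 : 0 < t := lt_of_lt_of_le (by positivity) ht
  have h1 := hn (1 / t) (by positivity) (by
    apply one_div_lt_one_div_of_lt (by positivity)
    calc (n : ℝ≥0) + 1 < n + 2 := by gcongr; norm_num
      _ ≤ t := ht)
  simp only [hY, one_div_one_div] at h1
  rw [dist_zero_right, Real.norm_eq_abs]
  calc _ = |((1 / t : ℝ≥0) : ℝ) * X t ω| := by simp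
    _ ≤ _ := h1
    _ < ε := hk

namespace PathSpace

variable {N : ℕ}

theorem continuous_coord (ω : PathSpace N) (i : ℕ) : Continuous (ω.coord i) := by
  unfold coord
  split_ifs with h
  · exact (continuous_apply _).comp ω.1.continuous
  · exact continuous_const

@[simp] theorem coord_zero (ω : PathSpace N) (i : ℕ) : ω.coord i 0 = 0 := by
  simp [coord, ω.2]

theorem coord_eq_zero (ω : PathSpace N) {i : ℕ} (hi : N ≤ i) (t : ℝ) : ω.coord i t = 0 := by
  simp [coord, not_lt.2 hi]

theorem coord_fin (ω : PathSpace N) (i : Fin N) (t : ℝ) : ω.coord i t = ω.1 t i := by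
  simp [coord]

theorem measurable_coord (i : ℕ) (t : ℝ) : Measurable fun ω : PathSpace N => ω.coord i t := by
  unfold coord
  split_ifs with h
  · refine Continuous.measurable ?_
    exact (continuous_apply _).comp ((continuous_eval_const t).comp
      continuous_subtype_val)
  · exact measurable_const

end PathSpace

theorem ae_mem_sublinearPaths {N : ℕ} {P : Measure (PathSpace N)} (hP : IsWienerMeasure P) :
    ∀ᵐ ω ∂P, ω ∈ sublinearPaths N := by
  have h1 : ∀ᵐ ω ∂P, ∀ i : Fin N,
      Tendsto (fun t : ℝ≥0 => (t : ℝ)⁻¹ * ω.coord i t) atTop (𝓝 0) :=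
    ae_all_iff.2 fun i => (hP.brownian_fwd i).ae_tendsto_div
      (fun t => PathSpace.measurable_coord _ _)
      (fun ω => (ω.continuous_coord i).comp NNReal.continuous_coe) (fun ω => by simp)
  have h2 : ∀ᵐ ω ∂P, ∀ i : Fin N,
      Tendsto (fun t : ℝ≥0 => (t : ℝ)⁻¹ * ω.coord i (-(t : ℝ))) atTop (𝓝 0) :=
    ae_all_iff.2 fun i => (hP.brownian_bwd i).ae_tendsto_div
      (fun t => PathSpace.measurable_coord _ _)
      (fun ω => (ω.continuous_coord i).comp NNReal.continuous_coe.neg) (fun ω => by simp)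
  filter_upwards [h1, h2] with ω h1 h2
  refine ⟨tendsto_pi_nhds.2 fun i => ?_, tendsto_pi_nhds.2 fun i => ?_⟩
  · refine ((h1 i).comp Real.tendsto_toNNReal_atTop).congr' ?_
    filter_upwards [eventually_ge_atTop 0] with t ht
    simp [ht, PathSpace.coord_fin]
  · have := ((h2 i).comp (Real.tendsto_toNNReal_atTop.comp tendsto_neg_atBot_atTop)).neg
    simp only [neg_zero] at this
    refine this.congr' ?_
    filter_upwards [eventually_le_atBot 0] with t ht
    simp [ht, PathSpace.coord_fin]

/-- Write `(f (s + t) - c) / s = (1 + t / s) · f (s + t) / (s + t) - c / s`. A general filter covers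
both ends of the line. -/
theorem tendsto_inv_smul_shift {E : Type*} [NormedAddCommGroup E] [NormedSpace ℝ E] {l : Filter ℝ}
    {f : ℝ → E} {t : ℝ} (hinv : Tendsto (fun s : ℝ => s⁻¹) l (𝓝 0)) (hne : ∀ᶠ s in l, s + t ≠ 0)
    (hl : Tendsto (fun s => s + t) l l) (hf : Tendsto (fun s => s⁻¹ • f s) l (𝓝 0))
    (c : E) (hs : ∀ᶠ s in l, s ≠ 0) :
    Tendsto (fun s => s⁻¹ • (f (s + t) - c)) l (𝓝 0) := by
  have h1 : Tendsto (fun s : ℝ => 1 + s⁻¹ * t) l (𝓝 1) := by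
    simpa using (hinv.mul_const t).const_add 1
  have h2 := (h1.smul (hf.comp hl)).sub (hinv.smul_const c)
  simp only [smul_zero, zero_smul, sub_zero] at h2
  refine h2.congr' ?_
  filter_upwards [hne, hs] with s h h'
  simp only [Function.comp]
  rw [smul_smul, smul_sub]
  congr 2
  field_simp

theorem shift_mem_sublinearPaths {N : ℕ} (t : ℝ) {ω : PathSpace N} (h : ω ∈ sublinearPaths N) :
    shift t ω ∈ sublinearPaths N := by
  refine ⟨?_, ?_⟩
  · exact tendsto_inv_smul_shift tendsto_inv_atTop_zero
      ((tendsto_atTop_add_const_right _ t tendsto_id).eventually (eventually_ne_atTop 0))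
      (tendsto_atTop_add_const_right _ t tendsto_id) h.1 _ (eventually_ne_atTop 0)
  · exact tendsto_inv_smul_shift tendsto_inv_atBot_zero
      ((tendsto_atBot_add_const_right _ t tendsto_id).eventually (eventually_ne_atBot 0))
      (tendsto_atBot_add_const_right _ t tendsto_id) h.2 _ (eventually_ne_atBot 0)

theorem shift_neg_shift {N : ℕ} (t : ℝ) (ω : PathSpace N) : shift (-t) (shift t ω) = ω := by
  refine Subtype.ext (ContinuousMap.ext fun s => ?_)
  simp [shift, ω.2]

theorem shift_preimage_sublinearPaths {N : ℕ} (t : ℝ) :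
    shift t ⁻¹' sublinearPaths N = sublinearPaths N := by
  ext ω
  refine ⟨fun h => ?_, shift_mem_sublinearPaths t⟩
  rw [← shift_neg_shift t ω]
  exact shift_mem_sublinearPaths (-t) h

/-- Paths of sublinear growth are bounded by a multiple of `1 + |t|` on the negative half-line. -/
theorem exists_abs_coord_le {N : ℕ} {ω : PathSpace N} (h : ω ∈ sublinearPaths N) (i : ℕ) :
    ∃ C, 0 ≤ C ∧ ∀ t ≤ 0, |ω.coord i t| ≤ C * (1 + |t|) := by
  by_cases hi : i < N
  swap
  · exact ⟨0, le_rfl, fun t _ => by simp [ω.coord_eq_zero (not_lt.1 hi)]⟩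
  have h1 : Tendsto (fun t : ℝ => t⁻¹ * ω.coord i t) atBot (𝓝 0) := by
    have := (tendsto_pi_nhds.1 h.2) ⟨i, hi⟩
    simpa [PathSpace.coord, hi] using this
  have h2 : ∀ᶠ t in atBot, |t⁻¹ * ω.coord i t| < 1 :=
    (by simpa using h1.abs : Tendsto (fun t : ℝ => |t⁻¹ * ω.coord i t|) atBot (𝓝 0)).eventually
      (gt_mem_nhds one_pos)
  obtain ⟨a, ha⟩ := eventually_atBot.1 h2
  obtain ⟨C, hC⟩ := (isCompact_Icc (a := a) (b := 0)).exists_bound_of_continuousOn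
    (ω.continuous_coord i).continuousOn
  refine ⟨max C 1, by positivity, fun t ht => ?_⟩
  rcases le_total t a with hta | hta
  · rcases eq_or_ne t 0 with rfl | ht0
    · simp
    have := ha t hta
    rw [abs_mul, abs_inv, inv_mul_lt_iff₀ (abs_pos.2 ht0)] at this
    have h3 : 1 * (1 + |t|) ≤ max C 1 * (1 + |t|) := by gcongr; exact le_max_right _ _
    linarith
  · have := hC t ⟨hta, ht⟩
    rw [Real.norm_eq_abs] at this
    calc |ω.coord i t| ≤ max C 1 * 1 := by rw [mul_one]; exact this.trans (le_max_left _ _)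
      _ ≤ _ := by gcongr; linarith [abs_nonneg t]

/-! ### Scalar linear integral equations -/

/-- The solution `y(s) = ∫_0^s exp((s - r) β) k(r) dr` of `y' = β y + k`, `y(0) = 0`. -/
def duhamel (β : ℝ) (k : ℝ → ℝ) (s : ℝ) : ℝ := ∫ r in (0 : ℝ)..s, Real.exp ((s - r) * β) * k r

@[simp] theorem duhamel_zero_right (β : ℝ) (k : ℝ → ℝ) : duhamel β k 0 = 0 := by simp [duhamel]

/-- Factoring out `exp(s β)` leaves the primitive of a function independent of `s`. The sign of `s`
is free, so the same formula serves the backward and the forward equation. -/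
theorem hasDerivAt_duhamel (β : ℝ) {k : ℝ → ℝ} (hk : Continuous k) (s : ℝ) :
    HasDerivAt (duhamel β k) (β * duhamel β k s + k s) s := by
  have h1 : duhamel β k = fun s =>
      Real.exp (s * β) * ∫ r in (0 : ℝ)..s, Real.exp (-r * β) * k r := by
    funext s
    rw [duhamel, ← intervalIntegral.integral_const_mul]
    refine intervalIntegral.integral_congr fun r _ => ?_
    rw [← mul_assoc, ← Real.exp_add]
    ring_nf
  have h2 : Continuous fun r => Real.exp (-r * β) * k r := by fun_prop
  have h3 : HasDerivAt (fun s => Real.exp (s * β)) (Real.exp (s * β) * β) s := by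
    simpa using ((hasDerivAt_id s).mul_const β).exp
  have h4 := h3.mul (h2.integral_hasStrictDerivAt 0 s).hasDerivAt
  rw [h1]
  refine h4.congr_deriv ?_
  have : Real.exp (s * β) * (Real.exp (-s * β) * k s) = k s := by
    rw [← mul_assoc, ← Real.exp_add]; simp
  rw [this]; ring

theorem continuous_duhamel (β : ℝ) {k : ℝ → ℝ} (hk : Continuous k) : Continuous (duhamel β k) :=
  continuous_iff_continuousAt.2 fun s => (hasDerivAt_duhamel β hk s).continuousAt

theorem integral_duhamel (β : ℝ) {k : ℝ → ℝ} (hk : Continuous k) (s : ℝ) :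
    ∫ r in (0 : ℝ)..s, (β * duhamel β k r + k r) = duhamel β k s := by
  have hc := continuous_duhamel β hk
  rw [intervalIntegral.integral_eq_sub_of_hasDerivAt (fun r _ => hasDerivAt_duhamel β hk r)
    (Continuous.intervalIntegrable (by fun_prop) _ _)]
  simp

theorem exp_mul_eq_integral (β s : ℝ) :
    Real.exp (s * β) = 1 + ∫ r in (0 : ℝ)..s, β * Real.exp (r * β) := by
  have h3 : ∀ s, HasDerivAt (fun s => Real.exp (s * β)) (β * Real.exp (s * β)) s := fun s => by
    simpa [mul_comm] using ((hasDerivAt_id s).mul_const β).exp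
  rw [intervalIntegral.integral_eq_sub_of_hasDerivAt (fun r _ => h3 r)
    (Continuous.intervalIntegrable (by fun_prop) _ _)]
  simp

/-- A homogeneous linear scalar integral equation has only the zero solution. -/
theorem eq_zero_of_eq_integral {a b β : ℝ} (ha : a ≤ 0) (hb : 0 ≤ b) {w : ℝ → ℝ}
    (hw : ContinuousOn w (Icc a b)) (h : ∀ s ∈ Icc a b, w s = β * ∫ r in (0 : ℝ)..s, w r) :
    ∀ s ∈ Icc a b, w s = 0 := by
  have hab : a ≤ b := ha.trans hb
  have h0 : (0 : ℝ) ∈ Icc a b := ⟨ha, hb⟩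
  -- Constant extension beyond `[a, b]` gives the primitive a two-sided derivative at the endpoints
  -- as well.
  set v : ℝ → ℝ := IccExtend hab ((Icc a b).domRestrict w) with hv
  have hvc : Continuous v := (continuousOn_iff_continuous_domRestrict.1 hw).Icc_extend'
  have hvw : ∀ s ∈ Icc a b, v s = w s := fun s hs => by
    rw [hv, IccExtend_of_mem hab _ hs]; rfl
  have hint : ∀ s ∈ Icc a b, ∫ r in (0 : ℝ)..s, w r = ∫ r in (0 : ℝ)..s, v r := fun s hs =>
    intervalIntegral.integral_congr fun r hr => (hvw r (uIcc_subset_Icc h0 hs hr)).symm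
  -- Integrating factor: the equation says `w = β ∫ w`, so `q' = 0` on `[a, b]`, while `q 0 = 0`.
  set q : ℝ → ℝ := fun s => Real.exp (s * -β) * ∫ r in (0 : ℝ)..s, v r with hq
  have hqd : ∀ s ∈ Icc a b, HasDerivAt q 0 s := fun s hs => by
    have h3 : HasDerivAt (fun s => Real.exp (s * -β)) (Real.exp (s * -β) * -β) s := by
      simpa using ((hasDerivAt_id s).mul_const (-β)).exp
    have h4 := h3.mul (hvc.integral_hasStrictDerivAt 0 s).hasDerivAt
    refine h4.congr_deriv ?_
    rw [hvw s hs, h s hs, hint s hs]; ring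
  have hconst := constant_of_derivWithin_zero (f := q) (a := a) (b := b)
    (fun s hs => (hqd s hs).differentiableAt.differentiableWithinAt)
    (fun s hs => (hqd s (Ico_subset_Icc_self hs)).hasDerivWithinAt.derivWithin
      (uniqueDiffOn_Icc (hs.1.trans_lt hs.2) s (Ico_subset_Icc_self hs)))
  intro s hs
  have h5 : q s = 0 := by
    rw [hconst s hs, ← hconst 0 h0]; simp [hq]
  have h6 : ∫ r in (0 : ℝ)..s, v r = 0 := by
    simpa [hq, (Real.exp_pos _).ne'] using h5
  rw [h s hs, hint s hs, h6, mul_zero]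

/-! ### Growth on the negative half-line -/

/-- `f` is continuous and `O((1 + |τ|)² (a + exp(τ β)))` on the negative half-line. -/
def HasGrowth (a β : ℝ) (f : ℝ → ℝ) : Prop :=
  Continuous f ∧ ∃ C, 0 ≤ C ∧ ∀ τ ≤ 0, |f τ| ≤ C * (1 + |τ|) ^ 2 * (a + Real.exp (τ * β))

theorem HasGrowth.add {a β : ℝ} {f g : ℝ → ℝ} (hf : HasGrowth a β f) (hg : HasGrowth a β g) :
    HasGrowth a β fun τ => f τ + g τ := by
  obtain ⟨hfc, C, hC, hf⟩ := hf
  obtain ⟨hgc, D, hD, hg⟩ := hg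
  refine ⟨hfc.add hgc, C + D, by positivity, fun τ hτ => ?_⟩
  calc _ ≤ |f τ| + |g τ| := abs_add_le _ _
    _ ≤ _ := add_le_add (hf τ hτ) (hg τ hτ)
    _ = _ := by ring

theorem HasGrowth.const_mul {a β : ℝ} {f : ℝ → ℝ} (hf : HasGrowth a β f) (c : ℝ) :
    HasGrowth a β fun τ => c * f τ := by
  obtain ⟨hfc, C, hC, hf⟩ := hf
  refine ⟨hfc.const_mul c, |c| * C, by positivity, fun τ hτ => ?_⟩
  rw [abs_mul, mul_assoc, mul_assoc]
  gcongr
  rw [← mul_assoc]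
  exact hf τ hτ

theorem hasGrowth_exp {a : ℝ} (ha : 0 ≤ a) (β : ℝ) : HasGrowth a β fun τ => Real.exp (β * τ) := by
  refine ⟨by fun_prop, 1, zero_le_one, fun τ _ => ?_⟩
  rw [abs_of_pos (Real.exp_pos _), mul_comm β]
  have h1 : 1 ≤ (1 + |τ|) ^ 2 := one_le_pow₀ (by linarith [abs_nonneg τ])
  have h2 := Real.exp_pos (τ * β)
  nlinarith

/-- Half of the rate absorbs the polynomial, by `x ^ n / n! ≤ exp x` at `x = (γ / 2)(1 + |τ|)`; the
other half is integrable. -/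
theorem integrableOn_pow_mul_exp (n : ℕ) {γ : ℝ} (hγ : 0 < γ) :
    IntegrableOn (fun τ : ℝ => (1 + |τ|) ^ n * Real.exp (γ * τ)) (Iic 0) := by
  have h1 : IntegrableOn (fun τ : ℝ => (n.factorial * (2 / γ) ^ n * Real.exp (γ / 2)) *
      Real.exp (γ / 2 * τ)) (Iic 0) :=
    (integrableOn_exp_mul_Iic (by positivity) 0).const_mul _
  refine Integrable.mono' h1 (by fun_prop) ?_
  refine (ae_restrict_iff' measurableSet_Iic).2 (ae_of_all _ fun τ hτ => ?_)
  have hτ : τ ≤ 0 := hτ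
  rw [Real.norm_eq_abs, abs_of_nonneg (by positivity), abs_of_nonpos hτ]
  have h2 := Real.pow_div_factorial_le_exp (γ / 2 * (1 + -τ)) (by apply mul_nonneg <;> linarith) n
  rw [div_le_iff₀ (by positivity), mul_pow] at h2
  have h3 : (1 + -τ) ^ n ≤ (2 / γ) ^ n * (Real.exp (γ / 2 * (1 + -τ)) * n.factorial) := by
    calc (1 + -τ) ^ n = (2 / γ) ^ n * ((γ / 2) ^ n * (1 + -τ) ^ n) := by
          rw [← mul_assoc, ← mul_pow, div_mul_div_cancel₀ hγ.ne', div_self two_ne_zero,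
            one_pow, one_mul]
      _ ≤ _ := by gcongr
  calc (1 + -τ) ^ n * Real.exp (γ * τ)
      ≤ (2 / γ) ^ n * (Real.exp (γ / 2 * (1 + -τ)) * n.factorial) * Real.exp (γ * τ) := by gcongr
    _ = (2 / γ) ^ n * n.factorial * (Real.exp (γ / 2 * (1 + -τ)) * Real.exp (γ * τ)) := by ring
    _ = (2 / γ) ^ n * n.factorial * (Real.exp (γ / 2) * Real.exp (γ / 2 * τ)) := by
        rw [← Real.exp_add, ← Real.exp_add]; ring_nf
    _ = _ := by ring

/-- The product of two functions of given growth, discounted at a rate which beats all the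
exponential rates in play, is dominated by an integrable function. -/
theorem HasGrowth.integrableOn_bound {a₁ a₂ β₁ β₂ c : ℝ}
    (h₁₂ : c < β₁ + β₂) (h₁ : a₁ ≠ 0 → c < β₂) (h₂ : a₂ ≠ 0 → c < β₁) (h₀ : c < 0) (C : ℝ) :
    IntegrableOn (fun τ : ℝ => C * (Real.exp (-c * τ) * ((1 + |τ|) ^ 4 *
      ((a₁ + Real.exp (τ * β₁)) * (a₂ + Real.exp (τ * β₂)))))) (Iic 0) := by
  -- The product expands into four exponentials with coefficients `a₁ a₂`, `a₁`, `a₂`, `1`. A term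
  -- with zero coefficient needs no condition on its rate, whence the conditional hypotheses.
  have key : ∀ x γ : ℝ, (x ≠ 0 → 0 < γ) →
      IntegrableOn (fun τ : ℝ => x * ((1 + |τ|) ^ 4 * Real.exp (γ * τ))) (Iic 0) := by
    intro x γ h
    rcases eq_or_ne x 0 with rfl | hx
    · simp
    · exact (integrableOn_pow_mul_exp 4 (h hx)).const_mul x
  have h := (((key (a₁ * a₂) (-c) fun _ => by linarith).add
    (key a₁ (β₂ - c) fun h => by linarith [h₁ h])).add
    (key a₂ (β₁ - c) fun h => by linarith [h₂ h])).add
    (key 1 (β₁ + β₂ - c) fun _ => by linarith)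
  refine (Integrable.const_mul h C).congr (ae_of_all _ fun τ => ?_)
  simp only [Pi.add_apply]
  have e1 : Real.exp ((β₂ - c) * τ) = Real.exp (-c * τ) * Real.exp (τ * β₂) := by
    rw [← Real.exp_add]; ring_nf
  have e2 : Real.exp ((β₁ - c) * τ) = Real.exp (-c * τ) * Real.exp (τ * β₁) := by
    rw [← Real.exp_add]; ring_nf
  have e3 : Real.exp ((β₁ + β₂ - c) * τ) =
      Real.exp (-c * τ) * Real.exp (τ * β₁) * Real.exp (τ * β₂) := by
    rw [← Real.exp_add, ← Real.exp_add]; ring_nf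
  rw [e1, e2, e3]
  ring

theorem HasGrowth.exists_abs_mul_le {a₁ a₂ β₁ β₂ : ℝ} {f g : ℝ → ℝ} (hf : HasGrowth a₁ β₁ f)
    (hg : HasGrowth a₂ β₂ g) (ha₁ : 0 ≤ a₁) :
    ∃ C, ∀ τ ≤ 0, |f τ * g τ| ≤ C * ((1 + |τ|) ^ 4 *
      ((a₁ + Real.exp (τ * β₁)) * (a₂ + Real.exp (τ * β₂)))) := by
  obtain ⟨hfc, C, hC, hf⟩ := hf
  obtain ⟨hgc, D, hD, hg⟩ := hg
  refine ⟨C * D, fun τ hτ => ?_⟩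
  rw [abs_mul]
  calc _ ≤ (C * (1 + |τ|) ^ 2 * (a₁ + Real.exp (τ * β₁))) *
        (D * (1 + |τ|) ^ 2 * (a₂ + Real.exp (τ * β₂))) := by
        gcongr
        exacts [hf τ hτ, hg τ hτ]
    _ = _ := by ring

/-- A vector-valued integrand `(f g) • v` is integrable when `f`, `g` have given growth and `v` is
discounted at a rate which beats all the exponential rates in play. -/
theorem HasGrowth.integrableOn_smul {E : Type*} [NormedAddCommGroup E] [NormedSpace ℝ E]
    {a₁ a₂ β₁ β₂ c : ℝ} {f g : ℝ → ℝ}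
    (hf : HasGrowth a₁ β₁ f) (hg : HasGrowth a₂ β₂ g) (ha₁ : 0 ≤ a₁)
    (h₁₂ : c < β₁ + β₂) (h₁ : a₁ ≠ 0 → c < β₂) (h₂ : a₂ ≠ 0 → c < β₁) (h₀ : c < 0)
    {v : ℝ → E} (hv : ContinuousOn v (Iic 0)) {K : ℝ}
    (hvK : ∀ τ ≤ 0, ‖v τ‖ ≤ K * Real.exp (-c * τ)) :
    IntegrableOn (fun τ => (f τ * g τ) • v τ) (Iic 0) := by
  obtain ⟨C, hC⟩ := hf.exists_abs_mul_le hg ha₁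
  refine Integrable.mono' (HasGrowth.integrableOn_bound h₁₂ h₁ h₂ h₀ (C * K)) ?_ ?_
  · exact ((hf.1.mul hg.1).continuousOn.smul hv).aestronglyMeasurable measurableSet_Iic
  refine (ae_restrict_iff' measurableSet_Iic).2 (ae_of_all _ fun τ hτ => ?_)
  rw [norm_smul, Real.norm_eq_abs]
  calc _ ≤ (C * ((1 + |τ|) ^ 4 * ((a₁ + Real.exp (τ * β₁)) * (a₂ + Real.exp (τ * β₂))))) *
        (K * Real.exp (-c * τ)) := by
        refine mul_le_mul (hC τ hτ) (hvK τ hτ) (norm_nonneg _) ((abs_nonneg _).trans (hC τ hτ))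
    _ = _ := by ring

theorem HasGrowth.integrableOn {a₁ a₂ β₁ β₂ c : ℝ} {f g : ℝ → ℝ}
    (hf : HasGrowth a₁ β₁ f) (hg : HasGrowth a₂ β₂ g) (ha₁ : 0 ≤ a₁)
    (h₁₂ : c < β₁ + β₂) (h₁ : a₁ ≠ 0 → c < β₂) (h₂ : a₂ ≠ 0 → c < β₁) (h₀ : c < 0) :
    IntegrableOn (fun τ => Real.exp (-c * τ) * f τ * g τ) (Iic 0) := by
  have h := hf.integrableOn_smul hg ha₁ h₁₂ h₁ h₂ h₀ (v := fun τ => Real.exp (-c * τ)) (K := 1)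
    (by fun_prop) (fun τ _ => by simp)
  refine h.congr (ae_of_all _ fun τ => ?_)
  simp only [smul_eq_mul]
  ring

/-- An unforced coordinate vanishes identically, so `1 ≤ a` is needed only for forced modes. -/
theorem hasGrowth_coord {N : ℕ} {ω : PathSpace N} (h : ω ∈ sublinearPaths N) (i : ℕ) {a : ℝ}
    (ha : 0 ≤ a) (hai : i < N → 1 ≤ a) (β : ℝ) : HasGrowth a β (ω.coord i) := by
  obtain ⟨C, hC, hb⟩ := exists_abs_coord_le h i
  refine ⟨ω.continuous_coord i, C, hC, fun τ hτ => ?_⟩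
  by_cases hi : i < N
  · have h1 : 1 ≤ a := hai hi
    have h3 : 1 ≤ a + Real.exp (τ * β) := by linarith [Real.exp_pos (τ * β)]
    have h4 : 1 ≤ 1 + |τ| := by linarith [abs_nonneg τ]
    calc _ ≤ C * (1 + |τ|) := hb τ hτ
      _ ≤ C * (1 + |τ|) ^ 2 := by gcongr; exact le_self_pow₀ h4 two_ne_zero
      _ ≤ _ := le_mul_of_one_le_right (by positivity) h3
  · rw [ω.coord_eq_zero (not_lt.1 hi)]
    simp only [abs_zero]
    positivity

/-- For `τ ≤ r ≤ 0` the kernel `exp((τ - r) β)` is at most `1` if `β ≥ 0` and at most `exp(τ β)` if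
`β ≤ 0`. The length of the interval contributes the second factor `1 + |τ|`, which explains the
square in `HasGrowth`. -/
theorem hasGrowth_duhamel {N : ℕ} {ω : PathSpace N} (h : ω ∈ sublinearPaths N) (i : ℕ) {a : ℝ}
    (ha : 0 ≤ a) (hai : i < N → 1 ≤ a) (β : ℝ) : HasGrowth a β (duhamel β (ω.coord i)) := by
  obtain ⟨C, hC, hb⟩ := exists_abs_coord_le h i
  refine ⟨continuous_duhamel β (ω.continuous_coord i), C, hC, fun τ hτ => ?_⟩
  by_cases hi : i < N
  · have h1 : 1 ≤ a := hai hi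
    have hbd : ∀ r ∈ uIoc 0 τ, ‖Real.exp ((τ - r) * β) * ω.coord i r‖ ≤
        (a + Real.exp (τ * β)) * (C * (1 + |τ|)) := by
      intro r hr
      rw [uIoc_of_ge hτ] at hr
      rw [norm_mul, Real.norm_eq_abs, Real.norm_eq_abs, abs_of_pos (Real.exp_pos _)]
      have hr0 : |r| ≤ |τ| := by rw [abs_of_nonpos hr.2, abs_of_nonpos hτ]; linarith [hr.1]
      have h5 : Real.exp ((τ - r) * β) ≤ a + Real.exp (τ * β) := by
        rcases le_total 0 β with hβ | hβ
        · have : Real.exp ((τ - r) * β) ≤ 1 := by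
            rw [Real.exp_le_one_iff]
            exact mul_nonpos_of_nonpos_of_nonneg (by linarith [hr.1]) hβ
          linarith [Real.exp_pos (τ * β)]
        · have : Real.exp ((τ - r) * β) ≤ Real.exp (τ * β) := by
            rw [Real.exp_le_exp]
            nlinarith [hr.2]
          linarith
      have h6 : |ω.coord i r| ≤ C * (1 + |τ|) := (hb r hr.2).trans (by gcongr)
      gcongr
    have := intervalIntegral.norm_integral_le_of_norm_le_const hbd
    rw [sub_zero, Real.norm_eq_abs] at this
    calc _ ≤ (a + Real.exp (τ * β)) * (C * (1 + |τ|)) * |τ| := this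
      _ ≤ (a + Real.exp (τ * β)) * (C * (1 + |τ|)) * (1 + |τ|) := by gcongr; linarith
      _ = _ := by ring
  · have : duhamel β (ω.coord i) τ = 0 := by simp [duhamel, ω.coord_eq_zero (not_lt.1 hi)]
    rw [this, abs_zero]
    positivity

/-- In a sequence tending to `-∞`, strict upper bounds can be improved. -/
theorem exists_lt_forall_le {β : ℕ → ℝ} (hβ : Tendsto β atTop atBot) {A : Set ℕ} {c : ℝ}
    (h : ∀ n ∈ A, β n < c) : ∃ c' < c, ∀ n ∈ A, β n ≤ c' := by
  obtain ⟨n₀, hn₀⟩ := eventually_atTop.1 (hβ.eventually_le_atBot (c - 1))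
  have key : ∀ n₀ : ℕ, ∃ c' < c, ∀ n ∈ A, n < n₀ → β n ≤ c' := by
    intro n₀
    induction n₀ with
    | zero => exact ⟨c - 1, by linarith, fun n _ hn => absurd hn (Nat.not_lt_zero n)⟩
    | succ k ih =>
      obtain ⟨c', hc', hk⟩ := ih
      by_cases hkA : k ∈ A
      · refine ⟨max c' (β k), max_lt hc' (h k hkA), fun n hn hnk => ?_⟩
        rcases Nat.lt_succ_iff_lt_or_eq.1 hnk with hlt | rfl
        · exact (hk n hn hlt).trans (le_max_left _ _)
        · exact le_max_right _ _
      · refine ⟨c', hc', fun n hn hnk => ?_⟩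
        rcases Nat.lt_succ_iff_lt_or_eq.1 hnk with hlt | rfl
        · exact hk n hn hlt
        · exact absurd hn hkA
  obtain ⟨c', hc', hk⟩ := key n₀
  refine ⟨max c' (c - 1), max_lt hc' (by linarith), fun n hn => ?_⟩
  rcases lt_or_ge n n₀ with hlt | hge
  · exact (hk n hn hlt).trans (le_max_left _ _)
  · exact (hn₀ n hge).trans (le_max_right _ _)

/-! ### Diagonal operators in a Hilbert basis -/

section Diagonal

variable {E : Type*} [NormedAddCommGroup E] [InnerProductSpace ℝ E]

theorem hilbertBasis_ext (b : HilbertBasis ℕ ℝ E) {x y : E}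
    (h : ∀ n, inner ℝ (b n) x = inner ℝ (b n) y) : x = y := by
  refine b.repr.injective (lp.ext (funext fun n => ?_))
  rw [b.repr_apply_apply, b.repr_apply_apply, h n]

theorem hasSum_sq_hilbertBasis (b : HilbertBasis ℕ ℝ E) (x : E) :
    HasSum (fun n => (inner ℝ (b n) x) ^ 2) (‖x‖ ^ 2) := by
  have := b.hasSum_inner_mul_inner x x
  rw [real_inner_self_eq_norm_sq] at this
  refine this.congr_fun ?_
  intro n
  rw [real_inner_comm x (b n)]
  ring

/-- Sequences dominated by the coordinates of a vector are coordinates of a vector. -/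
theorem hasSum_of_abs_le_inner (b : HilbertBasis ℕ ℝ E) (x : E) {d : ℕ → ℝ} {K : ℝ}
    (h : ∀ n, |d n| ≤ K * |inner ℝ (b n) x|) :
    HasSum (fun n => d n • b n) (∑' n, d n • b n) ∧
      ∀ n, inner ℝ (b n) (∑' k, d k • b k) = d n := by
  have hd : Memℓp d 2 := by
    refine memℓp_gen ?_
    refine Summable.of_nonneg_of_le (fun n => by positivity) (fun n => ?_)
      ((hasSum_sq_hilbertBasis b x).summable.mul_left (K ^ 2))
    have h1 : (2 : ENNReal).toReal = ((2 : ℕ) : ℝ) := by norm_num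
    rw [h1, Real.rpow_natCast, Real.norm_eq_abs]
    calc |d n| ^ 2 ≤ (K * |inner ℝ (b n) x|) ^ 2 := by gcongr; exact h n
      _ = _ := by rw [mul_pow, sq_abs]
  have hs := b.hasSum_repr_symm (⟨d, hd⟩ : lp (fun _ : ℕ => ℝ) 2)
  have hs' : HasSum (fun n => d n • b n) (b.repr.symm ⟨d, hd⟩) := hs
  refine ⟨hs'.summable.hasSum, fun n => ?_⟩
  rw [hs'.tsum_eq, ← b.repr_apply_apply, LinearIsometryEquiv.apply_symm_apply]

/-- Parseval, compared term by term. -/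
theorem norm_le_of_abs_inner_le (b : HilbertBasis ℕ ℝ E) {x y : E} {K : ℝ} (hK : 0 ≤ K)
    (h : ∀ n, |inner ℝ (b n) y| ≤ K * |inner ℝ (b n) x|) : ‖y‖ ≤ K * ‖x‖ := by
  have h1 := hasSum_le (fun n => ?_) (hasSum_sq_hilbertBasis b y)
    ((hasSum_sq_hilbertBasis b x).mul_left (K ^ 2))
  · rw [← mul_pow] at h1
    exact le_of_sq_le_sq h1 (by positivity)
  · calc (inner ℝ (b n) y) ^ 2 = |inner ℝ (b n) y| ^ 2 := (sq_abs _).symm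
      _ ≤ (K * |inner ℝ (b n) x|) ^ 2 := by gcongr; exact h n
      _ = _ := by rw [mul_pow, sq_abs]

end Diagonal

namespace Setting

variable {H H₁ Hα : Type*}
  [NormedAddCommGroup H] [InnerProductSpace ℝ H] [CompleteSpace H]
  [NormedAddCommGroup H₁] [InnerProductSpace ℝ H₁] [CompleteSpace H₁]
  [NormedAddCommGroup Hα] [NormedSpace ℝ Hα] {N : ℕ}
  (S : Setting H H₁ Hα N)

/-! ### Coordinates -/

/-- The coordinate functional `⟨·, e_k⟩`. -/
def coeffL (k : ℕ) : H →L[ℝ] ℝ := innerSL ℝ (S.b k)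

@[simp] theorem coeffL_apply (k : ℕ) (x : H) : S.coeffL k x = S.coeff k x := rfl

theorem coeff_add (k : ℕ) (x y : H) : S.coeff k (x + y) = S.coeff k x + S.coeff k y :=
  (S.coeffL k).map_add x y

theorem coeff_sub (k : ℕ) (x y : H) : S.coeff k (x - y) = S.coeff k x - S.coeff k y :=
  (S.coeffL k).map_sub x y

theorem coeff_smul (k : ℕ) (c : ℝ) (x : H) : S.coeff k (c • x) = c * S.coeff k x :=
  (S.coeffL k).map_smul c x

theorem coeff_sum (k : ℕ) {α : Type*} (s : Finset α) (f : α → H) :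
    S.coeff k (∑ i ∈ s, f i) = ∑ i ∈ s, S.coeff k (f i) :=
  map_sum (S.coeffL k) f s

theorem coeff_b (k n : ℕ) : S.coeff k (S.b n) = if k = n then 1 else 0 := by
  rw [coeff, orthonormal_iff_ite.1 S.b.orthonormal]

theorem ext_coeff {x y : H} (h : ∀ n, S.coeff n x = S.coeff n y) : x = y :=
  hilbertBasis_ext S.b h

theorem coeff_sum_smul_b (k : ℕ) (s : Finset ℕ) (c : ℕ → ℝ) :
    S.coeff k (∑ i ∈ s, c i • S.b i) = if k ∈ s then c k else 0 := by
  rw [coeff_sum]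
  simp [coeff_smul, coeff_b]

theorem ι_sum_smul_e (s : Finset ℕ) (c : ℕ → ℝ) :
    S.ι (∑ i ∈ s, c i • S.e i) = ∑ i ∈ s, c i • S.b i := by
  simp [map_sum, S.ι_e]

theorem coeff_ι_sum_smul_e (k : ℕ) (s : Finset ℕ) (c : ℕ → ℝ) :
    S.coeff k (S.ι (∑ i ∈ s, c i • S.e i)) = if k ∈ s then c k else 0 := by
  rw [ι_sum_smul_e, coeff_sum_smul_b]

theorem L_e (k : ℕ) : S.L (S.e k) = S.β k • S.b k := S.eigen k

/-! ### Consequences of self-adjointness -/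

theorem unboundedOp_apply (φ : H₁) (h : S.ι φ ∈ (unboundedOp S.ι S.ι_injective S.L).domain) :
    unboundedOp S.ι S.ι_injective S.L ⟨S.ι φ, h⟩ = S.L φ := by
  change S.L ((LinearEquiv.ofInjective (S.ι : H₁ →ₗ[ℝ] H) S.ι_injective).symm ⟨S.ι φ, h⟩) = _
  congr 1
  rw [LinearEquiv.symm_apply_eq]
  rfl

theorem ι_mem_domain (φ : H₁) : S.ι φ ∈ (unboundedOp S.ι S.ι_injective S.L).domain :=
  ⟨φ, rfl⟩

theorem inner_L_comm (φ ψ : H₁) : inner ℝ (S.L φ) (S.ι ψ) = inner ℝ (S.ι φ) (S.L ψ) := by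
  have hA : IsSelfAdjoint (unboundedOp S.ι S.ι_injective S.L) := S.selfAdjoint
  have h := LinearPMap.adjoint_isFormalAdjoint hA.dense_domain
  rw [LinearPMap.isSelfAdjoint_def.1 hA] at h
  have := h ⟨S.ι φ, S.ι_mem_domain φ⟩ ⟨S.ι ψ, S.ι_mem_domain ψ⟩
  rwa [unboundedOp_apply, unboundedOp_apply] at this

/-- Symmetry moves `L` onto the eigenvector, so `L` is diagonal on its whole domain and not only on
finite combinations of the `e_k`. -/
theorem coeff_L (k : ℕ) (φ : H₁) : S.coeff k (S.L φ) = S.β k * S.coeff k (S.ι φ) := by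
  have := S.inner_L_comm (S.e k) φ
  rw [S.ι_e, S.L_e, real_inner_smul_left] at this
  exact this.symm

/-- The norm of `H₁` is controlled by the graph norm of `L_λ`. -/
theorem exists_norm_le_graph : ∃ C : ℝ, 0 ≤ C ∧ ∀ x : H₁, ‖x‖ ≤ C * (‖S.ι x‖ + ‖S.L x‖) := by
  have hA : IsSelfAdjoint (unboundedOp S.ι S.ι_injective S.L) := S.selfAdjoint
  -- The range of `φ ↦ (ι φ, L φ)` is the graph of a self-adjoint operator, hence closed; an
  -- injective bounded map of Banach spaces with closed range is bounded below.
  have hr : Set.range (S.ι.prod S.L) = (unboundedOp S.ι S.ι_injective S.L).graph := by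
    ext ⟨x, y⟩
    simp only [mem_range, ContinuousLinearMap.prod_apply, SetLike.mem_coe,
      LinearPMap.mem_graph_iff]
    constructor
    · rintro ⟨φ, hφ⟩
      rw [Prod.mk.injEq] at hφ
      exact ⟨⟨S.ι φ, S.ι_mem_domain φ⟩, hφ.1, by rw [unboundedOp_apply]; exact hφ.2⟩
    · rintro ⟨⟨_, φ, rfl⟩, h1, h2⟩
      refine ⟨φ, Prod.ext h1 ?_⟩
      rw [← h2]
      exact (S.unboundedOp_apply φ _).symm
  obtain ⟨K, hK⟩ := (S.ι.prod S.L).antilipschitz_of_injective_of_isClosed_range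
    (fun x y hxy => S.ι_injective (congrArg Prod.fst hxy)) (by rw [hr]; exact hA.isClosed)
  refine ⟨K, K.2, fun x => ?_⟩
  have := hK.le_mul_dist x 0
  rw [dist_zero_right, map_zero, dist_zero_right] at this
  refine this.trans ?_
  gcongr
  simp only [ContinuousLinearMap.prod_apply, Prod.norm_mk]
  exact max_le (by linarith [norm_nonneg (S.L x)]) (by linarith [norm_nonneg (S.ι x)])

/-- By compactness of the embedding `H₁ ⊂ H` the eigenvalues do not accumulate: only finitely many
lie in a bounded set. -/
theorem tendsto_abs_β : Tendsto (fun n => |S.β n|) atTop atTop := by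
  obtain ⟨C, hC, hCb⟩ := S.exists_norm_le_graph
  by_contra hcon
  simp only [tendsto_atTop, not_forall, not_eventually, not_le] at hcon
  obtain ⟨M, hM⟩ := hcon
  obtain ⟨φ, hφ, hφM⟩ := extraction_of_frequently_atTop hM
  -- If `|β|` stayed bounded along a subsequence, these eigenvectors would be bounded in `H₁`, hence
  -- precompact in `H`; but orthonormal vectors are at mutual distance `√2`.
  have hbd : ∀ k, S.e (φ k) ∈ Metric.closedBall (0 : H₁) (C * (1 + M)) := fun k => by
    rw [mem_closedBall_zero_iff]
    refine (hCb _).trans ?_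
    rw [S.ι_e, S.L_e, norm_smul, S.b.orthonormal.1, Real.norm_eq_abs, mul_one]
    gcongr
    exact (hφM k).le
  obtain ⟨K, hK, hKs⟩ := S.ι_compact.image_closedBall_subset_compact
    (f := (S.ι : H₁ →ₗ[ℝ] H)) (C * (1 + M))
  obtain ⟨a, -, ψ, hψ, ha⟩ := hK.tendsto_subseq (x := fun k => S.b (φ k))
    (fun k => hKs ⟨_, hbd k, S.ι_e _⟩)
  obtain ⟨k₀, hk₀⟩ := Metric.cauchySeq_iff.1 ha.cauchySeq 1 one_pos
  have h1 := hk₀ k₀ le_rfl (k₀ + 1) (Nat.le_succ _)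
  have hne : φ (ψ k₀) ≠ φ (ψ (k₀ + 1)) := (hφ.comp hψ (Nat.lt_succ_self k₀)).ne
  simp only [Function.comp, dist_eq_norm] at h1
  have h2 : ‖S.b (φ (ψ k₀)) - S.b (φ (ψ (k₀ + 1)))‖ ^ 2 = 2 := by
    rw [norm_sub_sq_real, S.b.orthonormal.1, S.b.orthonormal.1, S.b.orthonormal.2 hne]
    norm_num
  nlinarith [norm_nonneg (S.b (φ (ψ k₀)) - S.b (φ (ψ (k₀ + 1))))]

theorem tendsto_β (hβ : ∀ n, S.m ≤ n → S.β n < 0) : Tendsto S.β atTop atBot := by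
  rw [← tendsto_neg_atTop_iff]
  refine S.tendsto_abs_β.congr' ?_
  filter_upwards [eventually_ge_atTop S.m] with n hn
  rw [abs_of_neg (hβ n hn)]

/-! ### Projections and the semigroup -/

theorem coeff_Pc (k : ℕ) (x : H) :
    S.coeff k (S.ι (S.Pc x)) = if k < S.m then S.coeff k x else 0 := by
  rw [Pc, coeff_ι_sum_smul_e]
  simp

theorem coeff_Ps (k : ℕ) (x : H) : S.coeff k (S.Ps x) = if S.m ≤ k then S.coeff k x else 0 := by
  rw [Ps, coeff_sub, coeff_Pc]
  by_cases h : k < S.m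
  · simp [h, not_le.2 h]
  · simp [h, not_lt.1 h]

theorem ι_Ps₁ (x : H₁) : S.ι (S.Ps₁ x) = S.Ps (S.ι x) := by simp [Ps₁, Ps]

theorem continuous_Pc : Continuous S.Pc := by
  unfold Pc
  exact continuous_finsetSum _ fun k _ => ((S.coeffL k).continuous).smul continuous_const

theorem continuous_Ps : Continuous S.Ps :=
  continuous_id.sub (S.ι.continuous.comp S.continuous_Pc)

theorem coeff_ι_W (ω : PathSpace N) (t : ℝ) (k : ℕ) :
    S.coeff k (S.ι (S.W ω t)) = S.σ k * ω.coord k t := by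
  rw [W, coeff_ι_sum_smul_e]
  split_ifs with h
  · rfl
  · rw [S.σ_zero k (by simpa using h), zero_mul]

/-- The signs of `t` and `β_n` keep the multipliers at most `1`, so the defining series really
converges and its `tsum` is not the default `0`. -/
theorem expLs_spec (hβ : ∀ n, S.m ≤ n → S.β n < 0) {t : ℝ} (ht : 0 ≤ t) (x : H) (n : ℕ) :
    S.coeff n (S.expLs t x) = if S.m ≤ n then Real.exp (t * S.β n) * S.coeff n x else 0 := by
  refine (hasSum_of_abs_le_inner S.b x (K := 1) fun n => ?_).2 n
  split_ifs with h
  · rw [abs_mul, abs_of_pos (Real.exp_pos _)]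
    refine mul_le_mul_of_nonneg_right ?_ (abs_nonneg _)
    rw [Real.exp_le_one_iff]
    exact mul_nonpos_of_nonneg_of_nonpos ht (hβ n h).le
  · rw [abs_zero]
    positivity

/-- Decay of the semigroup on the vectors supported by modes with eigenvalue at most `c`. -/
theorem norm_expLs_le (hβ : ∀ n, S.m ≤ n → S.β n < 0) {t : ℝ} (ht : 0 ≤ t) {x : H} {c : ℝ}
    (hc : ∀ n, S.m ≤ n → S.coeff n x ≠ 0 → S.β n ≤ c) :
    ‖S.expLs t x‖ ≤ Real.exp (t * c) * ‖x‖ := by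
  refine norm_le_of_abs_inner_le S.b (Real.exp_pos _).le fun n => ?_
  change |S.coeff n _| ≤ _ * |S.coeff n x|
  rw [S.expLs_spec hβ ht]
  split_ifs with h
  · rcases eq_or_ne (S.coeff n x) 0 with h0 | h0
    · simp [h0]
    · rw [abs_mul, abs_of_pos (Real.exp_pos _)]
      gcongr
      exact hc n h h0
  · rw [abs_zero]
    positivity

theorem norm_expLs_sub_le (hβ : ∀ n, S.m ≤ n → S.β n < 0) {t : ℝ} (ht : 0 ≤ t) (x y : H) :
    ‖S.expLs t x - S.expLs t y‖ ≤ ‖x - y‖ := by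
  have h : S.expLs t x - S.expLs t y = S.expLs t (x - y) := by
    refine S.ext_coeff fun n => ?_
    rw [coeff_sub, S.expLs_spec hβ ht, S.expLs_spec hβ ht, S.expLs_spec hβ ht, coeff_sub]
    split_ifs <;> ring
  rw [h]
  simpa using S.norm_expLs_le hβ ht (x := x - y) (c := 0) fun n hn _ => (hβ n hn).le

/-- Each operator is a contraction, so the orbits of finite truncations of `x`, which are visibly
continuous, converge uniformly in `t`. -/
theorem continuousOn_expLs (hβ : ∀ n, S.m ≤ n → S.β n < 0) (x : H) :
    ContinuousOn (fun t => S.expLs t x) (Ici 0) := by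
  set xK : ℕ → H := fun K => ∑ k ∈ Finset.range K, S.coeff k x • S.b k with hxK
  have hlim : Tendsto xK atTop (𝓝 x) := by
    have := (S.b.hasSum_repr x).tendsto_sum_nat
    simp only [S.b.repr_apply_apply] at this
    exact this
  have hu : TendstoUniformlyOn (fun K t => S.expLs t (xK K)) (fun t => S.expLs t x) atTop
      (Ici 0) := by
    rw [Metric.tendstoUniformlyOn_iff]
    intro ε hε
    filter_upwards [Metric.tendsto_nhds.1 hlim ε hε] with K hK t ht
    rw [dist_comm, dist_eq_norm]
    exact (S.norm_expLs_sub_le hβ ht _ _).trans_lt (by rwa [← dist_eq_norm])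
  refine hu.continuousOn (Eventually.frequently (Eventually.of_forall fun K => ?_))
  have : ContinuousOn (fun t : ℝ => ∑ k ∈ Finset.range K,
      (if S.m ≤ k then Real.exp (t * S.β k) * S.coeff k x else 0) • S.b k) (Ici 0) := by
    refine Continuous.continuousOn (continuous_finsetSum _ fun k _ => ?_)
    split_ifs <;> fun_prop
  refine this.congr fun t ht => S.ext_coeff fun n => ?_
  rw [S.expLs_spec hβ ht, coeff_sum_smul_b, coeff_sum_smul_b]
  split_ifs <;> simp

/-- Clamping the time at `0` gives a jointly continuous function on all of `ℝ × H`, as parametric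
integrals require. Joint continuity combines contractivity in `x` with strong continuity in `t`. -/
theorem continuous_expLs_max (hβ : ∀ n, S.m ≤ n → S.β n < 0) :
    Continuous fun p : ℝ × H => S.expLs (max p.1 0) p.2 := by
  refine continuous_iff_continuousAt.2 fun ⟨t₀, x₀⟩ => ?_
  have h1 : Continuous fun t : ℝ => S.expLs (max t 0) x₀ :=
    (S.continuousOn_expLs hβ x₀).comp_continuous (by fun_prop) fun t => le_max_right t 0
  have h2 : Tendsto (fun p : ℝ × H => S.expLs (max p.1 0) p.2 - S.expLs (max p.1 0) x₀)
      (𝓝 (t₀, x₀)) (𝓝 0) := by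
    refine squeeze_zero_norm (fun p => S.norm_expLs_sub_le hβ (le_max_right _ _) _ _) ?_
    have : Continuous fun p : ℝ × H => ‖p.2 - x₀‖ := by fun_prop
    simpa using this.tendsto (t₀, x₀)
  have h3 := h2.add ((h1.comp continuous_fst).tendsto (t₀, x₀))
  simpa [ContinuousAt] using h3

/-! ### The low modes -/

theorem J_eq (ω : PathSpace N) (i : ℕ) (τ : ℝ) :
    S.J ω i τ = -duhamel (S.β i) (ω.coord i) τ := by
  rw [J, duhamel, intervalIntegral.integral_symm]

theorem continuous_J (ω : PathSpace N) (i : ℕ) : Continuous (S.J ω i) := by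
  simp only [funext (S.J_eq ω i)]
  exact (continuous_duhamel _ (ω.continuous_coord i)).neg

/-- The `i`-th coordinate of the low-mode path. -/
def lowCoord (ω : PathSpace N) (ξ : H₁) (i : ℕ) (s : ℝ) : ℝ :=
  S.coeff i (S.ι ξ) * Real.exp (S.β i * s) +
    (S.σ i * ω.coord i s + -(S.σ i * S.β i) * S.J ω i s)

theorem continuous_lowCoord (ω : PathSpace N) (ξ : H₁) (i : ℕ) :
    Continuous (S.lowCoord ω ξ i) := by
  have h1 := ω.continuous_coord i
  have h2 := S.continuous_J ω i
  unfold lowCoord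
  fun_prop

theorem Lc_sum (c : ℕ → ℝ) :
    S.Lc (∑ k ∈ Finset.range S.m, c k • S.e k) =
      ∑ k ∈ Finset.range S.m, (S.β k * c k) • S.e k := by
  rw [Lc, Pc]
  refine Finset.sum_congr rfl fun k hk => ?_
  rw [coeff_L, coeff_ι_sum_smul_e, if_pos hk]

theorem integral_sum_smul_e {a b : ℝ} (s : Finset ℕ) {c : ℕ → ℝ → ℝ}
    (hc : ∀ k ∈ s, Continuous (c k)) :
    ∫ r in a..b, ∑ k ∈ s, c k r • S.e k = ∑ k ∈ s, (∫ r in a..b, c k r) • S.e k := by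
  rw [intervalIntegral.integral_finsetSum (f := fun k r => c k r • S.e k) fun k hk =>
    Continuous.intervalIntegrable ((hc k hk).smul continuous_const) _ _]
  refine Finset.sum_congr rfl fun k _ => ?_
  rw [intervalIntegral.integral_smul_const]

theorem lowPath_eq_sum (ω : PathSpace N) (ξ : H₁) (s : ℝ) :
    S.lowPath ω ξ s = ∑ k ∈ Finset.range S.m, S.lowCoord ω ξ k s • S.e k := by
  have h1 : ∀ τ, S.expLc (s - τ) (S.Lc (S.Pc (S.ι (S.W ω τ)))) =
      ∑ k ∈ Finset.range S.m,
        (S.σ k * S.β k * (Real.exp ((s - τ) * S.β k) * ω.coord k τ)) • S.e k := by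
    intro τ
    rw [Pc, Lc_sum, expLc]
    refine Finset.sum_congr rfl fun k hk => ?_
    rw [coeff_ι_sum_smul_e, if_pos hk, coeff_ι_W]
    ring_nf
  have h2 : ∫ τ in s..0, S.expLc (s - τ) (S.Lc (S.Pc (S.ι (S.W ω τ)))) =
      ∑ k ∈ Finset.range S.m, (S.σ k * S.β k * S.J ω k s) • S.e k := by
    simp only [h1]
    rw [S.integral_sum_smul_e _ fun k _ => by
      have := ω.continuous_coord k
      fun_prop]
    refine Finset.sum_congr rfl fun k _ => ?_
    rw [intervalIntegral.integral_const_mul, J]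
  rw [lowPath, h2, expLc, Pc, ← Finset.sum_add_distrib, ← Finset.sum_sub_distrib]
  refine Finset.sum_congr rfl fun k _ => ?_
  rw [← add_smul, ← sub_smul, coeff_ι_W, lowCoord]
  congr 1
  rw [mul_comm s]
  ring

theorem continuous_lowPath (ω : PathSpace N) (ξ : H₁) : Continuous (S.lowPath ω ξ) := by
  simp only [funext (S.lowPath_eq_sum ω ξ)]
  exact continuous_finsetSum _ fun k _ => (S.continuous_lowCoord ω ξ k).smul continuous_const

theorem sum_smul_e_mem_Hc (c : ℕ → ℝ) : ∑ k ∈ Finset.range S.m, c k • S.e k ∈ S.Hc :=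
  Submodule.sum_mem _ fun k hk => Submodule.smul_mem _ _
    (Submodule.subset_span ⟨k, Finset.mem_range.1 hk, rfl⟩)

theorem Pc_ι_of_mem_Hc {x : H₁} (hx : x ∈ S.Hc) : S.Pc (S.ι x) = x := by
  induction hx using Submodule.span_induction with
  | mem x hx =>
    obtain ⟨k, hk, rfl⟩ := hx
    have hk : k < S.m := hk
    simp [Pc, S.ι_e, coeff_b, hk]
  | zero => simp [Pc, coeff]
  | add x y _ _ hx hy =>
    nth_rw 2 [← hx, ← hy]
    simp [Pc, coeff_add, add_smul, Finset.sum_add_distrib]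
  | smul a x _ hx =>
    nth_rw 2 [← hx]
    simp [Pc, coeff_smul, mul_smul, Finset.smul_sum]

/-- Apart from the noise `σ W`, the coordinate is `ξ_k exp(β s)` plus `σ β` times a Duhamel
integral, and both parts are primitives of explicit functions whose sum is `β` times the coordinate.
-/
theorem lowCoord_eq_integral (ω : PathSpace N) (ξ : H₁) (k : ℕ) (s : ℝ) :
    S.lowCoord ω ξ k s = S.coeff k (S.ι ξ) - (∫ r in s..0, S.β k * S.lowCoord ω ξ k r) +
      S.σ k * ω.coord k s := by
  have hW := ω.continuous_coord k
  have hd := continuous_duhamel (S.β k) hW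
  have h1 : ∀ r, S.β k * S.lowCoord ω ξ k r = S.coeff k (S.ι ξ) * (S.β k * Real.exp (r * S.β k)) +
      S.σ k * S.β k * (S.β k * duhamel (S.β k) (ω.coord k) r + ω.coord k r) := by
    intro r
    rw [lowCoord, J_eq, mul_comm r]
    ring
  rw [intervalIntegral.integral_symm]
  simp only [h1]
  rw [intervalIntegral.integral_add (Continuous.intervalIntegrable (by fun_prop) _ _)
    (Continuous.intervalIntegrable (by fun_prop) _ _), intervalIntegral.integral_const_mul,
    intervalIntegral.integral_const_mul (S.σ k * S.β k), integral_duhamel _ hW]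
  have h2 := exp_mul_eq_integral (S.β k) s
  rw [lowCoord, J_eq, mul_comm (S.β k) s]
  rw [← sub_eq_iff_eq_add'] at h2
  rw [← h2]
  ring

theorem isLowSolution_lowPath (ω : PathSpace N) {ξ : H₁} (hξ : ξ ∈ S.Hc) (T : ℝ) :
    S.IsLowSolution ω ξ T (S.lowPath ω ξ) where
  mem s _ := by
    rw [lowPath_eq_sum]
    exact S.sum_smul_e_mem_Hc _
  cont := (S.continuous_lowPath ω ξ).continuousOn
  eq s _ := by
    simp only [S.lowPath_eq_sum, S.Lc_sum]
    rw [S.integral_sum_smul_e _ fun k _ => (S.continuous_lowCoord ω ξ k).const_mul _]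
    nth_rw 2 [← S.Pc_ι_of_mem_Hc hξ]
    rw [Pc, Pc, ← Finset.sum_sub_distrib, ← Finset.sum_add_distrib]
    refine Finset.sum_congr rfl fun k _ => ?_
    rw [← sub_smul, ← add_smul, coeff_ι_W, ← lowCoord_eq_integral]

theorem IsLowSolution.coeff_eq {S : Setting H H₁ Hα N} {ω : PathSpace N} {ξ : H₁} {T : ℝ}
    {u : ℝ → H₁} (hu : S.IsLowSolution ω ξ T u) {k : ℕ} (hk : k < S.m) {s : ℝ}
    (hs : s ∈ Icc (-T) 0) :
    S.coeff k (S.ι (u s)) = S.coeff k (S.ι ξ) + S.β k * (∫ r in (0 : ℝ)..s, S.coeff k (S.ι (u r))) +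
      S.σ k * ω.coord k s := by
  have hsub : uIcc s 0 ⊆ Icc (-T) 0 := by
    rw [uIcc_of_le hs.2]
    exact Icc_subset_Icc_left hs.1
  have hLc : Continuous S.Lc := S.continuous_Pc.comp S.L.continuous
  have hint : IntervalIntegrable (fun r => S.Lc (u r)) volume s 0 :=
    (hLc.comp_continuousOn (hu.cont.mono hsub)).intervalIntegrable
  have h1 := ((S.coeffL k).comp S.ι).intervalIntegral_comp_comm hint
  simp only [ContinuousLinearMap.comp_apply, coeffL_apply] at h1
  have h2 : ∀ x, S.coeff k (S.ι (S.Lc x)) = S.β k * S.coeff k (S.ι x) := fun x => by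
    rw [Lc, coeff_Pc, if_pos hk, coeff_L]
  simp only [h2, intervalIntegral.integral_const_mul] at h1
  rw [intervalIntegral.integral_symm] at h1
  rw [hu.eq s hs, map_add, map_sub, coeff_add, coeff_sub, coeff_Pc, if_pos hk, coeff_ι_W, ← h1]
  ring

/-- In the difference of two solutions the data and the noise cancel, leaving `w = β ∫ w` in each
coordinate. -/
theorem IsLowSolution.eqOn {S : Setting H H₁ Hα N} {ω : PathSpace N} {ξ : H₁} {T : ℝ} (hT : 0 ≤ T)
    {u v : ℝ → H₁} (hu : S.IsLowSolution ω ξ T u) (hv : S.IsLowSolution ω ξ T v) :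
    EqOn u v (Icc (-T) 0) := by
  have key : ∀ k < S.m, ∀ s ∈ Icc (-T) 0, S.coeff k (S.ι (u s)) - S.coeff k (S.ι (v s)) = 0 := by
    intro k hk
    have hcont : ∀ {u : ℝ → H₁}, S.IsLowSolution ω ξ T u →
        ContinuousOn (fun s => S.coeff k (S.ι (u s))) (Icc (-T) 0) := fun h =>
      ((S.coeffL k).comp S.ι).continuous.comp_continuousOn h.cont
    refine eq_zero_of_eq_integral (β := S.β k) (neg_nonpos.2 hT) le_rfl
      ((hcont hu).sub (hcont hv)) fun s hs => ?_
    have hsub : uIcc 0 s ⊆ Icc (-T) 0 := by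
      rw [uIcc_of_ge hs.2]
      exact Icc_subset_Icc_left hs.1
    rw [intervalIntegral.integral_sub ((hcont hu).mono hsub).intervalIntegrable
      ((hcont hv).mono hsub).intervalIntegrable, hu.coeff_eq hk hs, hv.coeff_eq hk hs]
    ring
  intro s hs
  rw [← S.Pc_ι_of_mem_Hc (hu.mem s hs), ← S.Pc_ι_of_mem_Hc (hv.mem s hs), Pc, Pc]
  refine Finset.sum_congr rfl fun k hk => ?_
  rw [sub_eq_zero.1 (key k (Finset.mem_range.1 hk) s hs)]

/-! ### The high modes -/

theorem continuous_Bq : Continuous S.Bq := by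
  unfold Bq
  fun_prop

theorem continuous_W (ω : PathSpace N) : Continuous (S.W ω) :=
  continuous_finsetSum _ fun i _ => ((ω.continuous_coord i).const_mul _).smul continuous_const

theorem continuous_Ps₁ : Continuous S.Ps₁ :=
  continuous_id.sub (S.continuous_Pc.comp S.ι.continuous)

theorem continuous_Ls : Continuous S.Ls := S.continuous_Ps.comp S.L.continuous

theorem coeff_Ls_Ps₁ (k : ℕ) (x : H₁) :
    S.coeff k (S.Ls (S.Ps₁ x)) = if S.m ≤ k then S.β k * S.coeff k (S.ι x) else 0 := by
  rw [Ls, coeff_Ps, coeff_L, ι_Ps₁, coeff_Ps]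
  split_ifs <;> rfl

/-- An equation in the coordinates of the eigenbasis implies the weak equation. -/
theorem weak_eq_of_coeff {u F : ℝ → H} (hu : Continuous u) (hF : Continuous F) {G : H} {s : ℝ}
    (h : ∀ n, S.coeff n (u s) =
      (∫ r in (0 : ℝ)..s, (S.β n * S.coeff n (u r) + S.coeff n (F r))) + S.coeff n G) (φ : H₁) :
    inner ℝ (S.ι φ) (u s) =
      (∫ r in (0 : ℝ)..s, (inner ℝ (S.L φ) (u r) + inner ℝ (S.ι φ) (F r))) +
        inner ℝ (S.ι φ) G := by
  have hcomm : ∀ (x : H) {v : ℝ → H}, Continuous v →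
      ∫ r in (0 : ℝ)..s, inner ℝ x (v r) = inner ℝ x (∫ r in (0 : ℝ)..s, v r) := fun x v hv =>
    (innerSL ℝ x).intervalIntegral_comp_comm (hv.intervalIntegrable _ _)
  have hI : ∀ (x : H) {v : ℝ → H}, Continuous v →
      IntervalIntegrable (fun r => inner ℝ x (v r)) volume 0 s := fun x v hv =>
    Continuous.intervalIntegrable (continuous_const.inner hv) _ _
  rw [intervalIntegral.integral_add (hI _ hu) (hI _ hF), hcomm _ hu, hcomm _ hF]
  set U := ∫ r in (0 : ℝ)..s, u r with hU
  set Φ := ∫ r in (0 : ℝ)..s, F r with hΦ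
  -- The integral `U` need not be known to lie in the domain. Parseval puts the factor `β_n` on the
  -- coordinates of `φ` instead, where it produces `L φ`.
  have hw : ∀ n, S.coeff n (u s - Φ - G) = S.β n * S.coeff n U := by
    intro n
    have h' := h n
    have i1 : IntervalIntegrable (fun r => S.β n * S.coeff n (u r)) volume 0 s :=
      (hI (S.b n) hu).const_mul _
    have i2 : IntervalIntegrable (fun r => S.coeff n (F r)) volume 0 s := hI (S.b n) hF
    rw [intervalIntegral.integral_add i1 i2, intervalIntegral.integral_const_mul] at h'
    have e1 : ∫ r in (0 : ℝ)..s, S.coeff n (u r) = S.coeff n U := hcomm (S.b n) hu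
    have e2 : ∫ r in (0 : ℝ)..s, S.coeff n (F r) = S.coeff n Φ := hcomm (S.b n) hF
    rw [e1, e2] at h'
    rw [coeff_sub, coeff_sub, h']
    ring
  have h1 := S.b.hasSum_inner_mul_inner (S.ι φ) (u s - Φ - G)
  have h2 := S.b.hasSum_inner_mul_inner (S.L φ) U
  have h3 : inner ℝ (S.ι φ) (u s - Φ - G) = inner ℝ (S.L φ) U := by
    refine h1.unique ?_
    convert h2 using 2 with n
    have e1 := hw n
    have e2 := S.coeff_L n φ
    simp only [coeff] at e1 e2
    rw [e1, real_inner_comm, real_inner_comm (S.b n) (S.L φ), e2]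
    ring
  rw [inner_sub_right, inner_sub_right] at h3
  linarith

/-- The mild solution of the high-mode equation driven by the low-mode path `uc`. -/
def highPath (ω : PathSpace N) (T : ℝ) (uc : ℝ → H₁) (s : ℝ) : H :=
  S.ι (S.Ps₁ (S.W (shift (-T) ω) s)) +
    ∫ r in (0 : ℝ)..s, S.expLs (max (s - r) 0)
      (S.Ps (S.Bq (uc (r - T))) + S.Ls (S.Ps₁ (S.W (shift (-T) ω) r)))

theorem continuous_highPath {S : Setting H H₁ Hα N} (hβ : ∀ n, S.m ≤ n → S.β n < 0)
    (ω : PathSpace N) (T : ℝ) {uc : ℝ → H₁} (huc : Continuous uc) :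
    Continuous (S.highPath ω T uc) := by
  have hW := S.continuous_W (shift (-T) ω)
  refine (S.ι.continuous.comp (S.continuous_Ps₁.comp hW)).add ?_
  refine intervalIntegral.continuous_parametric_intervalIntegral_of_continuous ?_ continuous_id
  refine (S.continuous_expLs_max hβ).comp (Continuous.prodMk (by fun_prop) ?_)
  refine Continuous.add ?_ ?_
  · exact S.continuous_Ps.comp (S.continuous_Bq.comp (huc.comp (by fun_prop)))
  · exact S.continuous_Ls.comp (S.continuous_Ps₁.comp (hW.comp continuous_snd))

/-- The stochastic convolution appears integrated by parts, as `W` plus a Duhamel integral with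
extra forcing `β_n σ_n W`, so no stochastic integral is needed. For `0 ≤ r ≤ s` the clamp in
`highPath` is inactive. -/
theorem coeff_highPath {S : Setting H H₁ Hα N} (hβ : ∀ n, S.m ≤ n → S.β n < 0)
    (ω : PathSpace N) (T : ℝ) {uc : ℝ → H₁} (huc : Continuous uc)
    {s : ℝ} (hs : 0 ≤ s) (n : ℕ) :
    S.coeff n (S.highPath ω T uc s) = if S.m ≤ n then
      S.σ n * (shift (-T) ω).coord n s +
        duhamel (S.β n) (fun r => S.coeff n (S.Bq (uc (r - T))) +
          S.β n * (S.σ n * (shift (-T) ω).coord n r)) s else 0 := by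
  have hW := S.continuous_W (shift (-T) ω)
  have hc : Continuous fun r : ℝ => S.expLs (max (s - r) 0)
      (S.Ps (S.Bq (uc (r - T))) + S.Ls (S.Ps₁ (S.W (shift (-T) ω) r))) := by
    refine (S.continuous_expLs_max hβ).comp (Continuous.prodMk (by fun_prop) (Continuous.add ?_ ?_))
    · exact S.continuous_Ps.comp (S.continuous_Bq.comp (huc.comp (by fun_prop)))
    · exact S.continuous_Ls.comp (S.continuous_Ps₁.comp hW)
  have h1 := (S.coeffL n).intervalIntegral_comp_comm (hc.intervalIntegrable (μ := volume) 0 s)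
  simp only [coeffL_apply] at h1
  rw [highPath, coeff_add, ι_Ps₁, coeff_Ps, coeff_ι_W, ← h1]
  have h2 : ∀ r ∈ uIcc 0 s, S.coeff n (S.expLs (max (s - r) 0)
      (S.Ps (S.Bq (uc (r - T))) + S.Ls (S.Ps₁ (S.W (shift (-T) ω) r)))) =
      if S.m ≤ n then Real.exp ((s - r) * S.β n) * (S.coeff n (S.Bq (uc (r - T))) +
          S.β n * (S.σ n * (shift (-T) ω).coord n r)) else 0 := by
    intro r hr
    rw [uIcc_of_le hs] at hr
    rw [max_eq_left (by linarith [hr.2]), S.expLs_spec hβ (by linarith [hr.2]), coeff_add,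
      coeff_Ps, coeff_Ls_Ps₁, coeff_ι_W]
    split_ifs <;> rfl
  rw [intervalIntegral.integral_congr h2]
  split_ifs
  · rfl
  · simp

theorem isHighSolution_highPath {S : Setting H H₁ Hα N} (hβ : ∀ n, S.m ≤ n → S.β n < 0)
    (ω : PathSpace N) (T : ℝ) {uc : ℝ → H₁} (huc : Continuous uc) :
    S.IsHighSolution ω T uc (S.highPath ω T uc) where
  mem s hs k hk := by
    rw [coeff_highPath hβ ω T huc hs.1, if_neg (not_le.2 hk)]
  cont := (continuous_highPath hβ ω T huc).continuousOn
  eq s hs φ := by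
    refine S.weak_eq_of_coeff (continuous_highPath hβ ω T huc)
      (F := fun r => S.Ps (S.Bq (uc (r - T))))
      (S.continuous_Ps.comp (S.continuous_Bq.comp (huc.comp (by fun_prop)))) (fun n => ?_) φ
    have hk : Continuous fun r => S.coeff n (S.Bq (uc (r - T))) +
        S.β n * (S.σ n * (shift (-T) ω).coord n r) := by
      refine Continuous.add ?_ ?_
      · exact (S.coeffL n).continuous.comp (S.continuous_Bq.comp (huc.comp (by fun_prop)))
      · have := (shift (-T) ω).continuous_coord n
        fun_prop
    have h1 : ∀ r ∈ uIcc 0 s, S.β n * S.coeff n (S.highPath ω T uc r) +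
        S.coeff n (S.Ps (S.Bq (uc (r - T)))) = if S.m ≤ n then
          S.β n * duhamel (S.β n) (fun r => S.coeff n (S.Bq (uc (r - T))) +
            S.β n * (S.σ n * (shift (-T) ω).coord n r)) r + (S.coeff n (S.Bq (uc (r - T))) +
            S.β n * (S.σ n * (shift (-T) ω).coord n r)) else 0 := by
      intro r hr
      rw [uIcc_of_le hs.1] at hr
      rw [coeff_highPath hβ ω T huc hr.1, coeff_Ps]
      split_ifs <;> ring
    rw [intervalIntegral.integral_congr h1, coeff_highPath hβ ω T huc hs.1, ι_Ps₁, coeff_Ps,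
      coeff_ι_W]
    split_ifs
    · rw [integral_duhamel _ hk]; ring
    · simp

/-- Testing with `φ = e_n` recovers the scalar equation of mode `n`; the low modes vanish by
membership in `H^s`. -/
theorem IsHighSolution.eqOn {S : Setting H H₁ Hα N} {ω : PathSpace N} {T : ℝ} {uc : ℝ → H₁}
    (huc : Continuous uc) {u v : ℝ → H} (hu : S.IsHighSolution ω T uc u)
    (hv : S.IsHighSolution ω T uc v) : EqOn u v (Icc 0 T) := by
  intro s hs
  have hT : 0 ≤ T := hs.1.trans hs.2
  refine S.ext_coeff fun n => ?_
  rcases lt_or_ge n S.m with hn | hn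
  · rw [hu.mem s hs n hn, hv.mem s hs n hn]
  have hcont : ∀ {u : ℝ → H}, S.IsHighSolution ω T uc u →
      ContinuousOn (fun s => S.coeff n (u s)) (Icc 0 T) := fun h =>
    (S.coeffL n).continuous.comp_continuousOn h.cont
  have hF : Continuous fun r => S.coeff n (S.Ps (S.Bq (uc (r - T)))) :=
    (S.coeffL n).continuous.comp (S.continuous_Ps.comp (S.continuous_Bq.comp
      (huc.comp (by fun_prop))))
  have heq : ∀ {u : ℝ → H}, S.IsHighSolution ω T uc u → ∀ s ∈ Icc 0 T, S.coeff n (u s) =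
      S.β n * (∫ r in (0 : ℝ)..s, S.coeff n (u r)) +
        (∫ r in (0 : ℝ)..s, S.coeff n (S.Ps (S.Bq (uc (r - T))))) +
        S.coeff n (S.ι (S.Ps₁ (S.W (shift (-T) ω) s))) := by
    intro u h s hs
    have hsub : uIcc 0 s ⊆ Icc 0 T := by
      rw [uIcc_of_le hs.1]
      exact Icc_subset_Icc_right hs.2
    have h1 := h.eq s hs (S.e n)
    simp only [S.ι_e, S.L_e, real_inner_smul_left] at h1
    have h2 : IntervalIntegrable (fun r => S.β n * S.coeff n (u r)) volume 0 s :=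
      (((hcont h).mono hsub).intervalIntegrable).const_mul _
    rw [← intervalIntegral.integral_const_mul,
      ← intervalIntegral.integral_add h2 (hF.intervalIntegrable _ _)]
    exact h1
  refine sub_eq_zero.1 (eq_zero_of_eq_integral (β := S.β n) (w := fun s =>
    S.coeff n (u s) - S.coeff n (v s)) le_rfl hT ((hcont hu).sub (hcont hv)) (fun s hs => ?_) s hs)
  have hsub : uIcc 0 s ⊆ Icc 0 T := by
    rw [uIcc_of_le hs.1]
    exact Icc_subset_Icc_right hs.2
  rw [intervalIntegral.integral_sub ((hcont hu).mono hsub).intervalIntegrable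
    ((hcont hv).mono hsub).intervalIntegrable, heq hu s hs, heq hv s hs]
  ring

/-- For `r ∈ [0, T]` the equation reads the low path only at `r - T ∈ [-T, 0]`, where uniqueness
identifies it. -/
theorem IsHighSolution.congr {S : Setting H H₁ Hα N} {ω : PathSpace N} {T : ℝ} {uc uc' : ℝ → H₁}
    {u : ℝ → H} (h : S.IsHighSolution ω T uc u) (huc : EqOn uc uc' (Icc (-T) 0)) :
    S.IsHighSolution ω T uc' u where
  mem := h.mem
  cont := h.cont
  eq s hs φ := by
    rw [h.eq s hs φ]
    congr 1
    refine intervalIntegral.integral_congr fun r hr => ?_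
    rw [uIcc_of_le hs.1] at hr
    rw [huc ⟨by linarith [hr.1], by linarith [hr.2, hs.2]⟩]

/-! ### Integrability of the coefficients -/

/-- The indicator of the forced modes. -/
def forced (_S : Setting H H₁ Hα N) (i : ℕ) : ℝ := if i < N then 1 else 0

theorem forced_nonneg (i : ℕ) : 0 ≤ S.forced i := by
  unfold forced
  split_ifs <;> norm_num

theorem σ_ne_zero_of_forced {i : ℕ} (h : S.forced i ≠ 0) : S.σ i ≠ 0 := by
  have : i < N := by
    by_contra hi
    exact h (if_neg hi)
  exact (S.σ_pos i this).ne'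

theorem hasGrowth_coord {ω : PathSpace N} (hω : ω ∈ sublinearPaths N) (i : ℕ) :
    HasGrowth (S.forced i) (S.β i) (ω.coord i) :=
  BackwardForward.hasGrowth_coord hω i (S.forced_nonneg i) (fun h => by simp [forced, h]) _

theorem hasGrowth_J {ω : PathSpace N} (hω : ω ∈ sublinearPaths N) (i : ℕ) :
    HasGrowth (S.forced i) (S.β i) (S.J ω i) := by
  have h := (hasGrowth_duhamel hω i (S.forced_nonneg i) (fun h => by simp [forced, h])
    (S.β i)).const_mul (-1)
  simpa only [neg_one_mul, ← J_eq] using h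

theorem hasGrowth_lowCoord {ω : PathSpace N} (hω : ω ∈ sublinearPaths N) (ξ : H₁) (i : ℕ) :
    HasGrowth (S.forced i) (S.β i) (S.lowCoord ω ξ i) :=
  ((hasGrowth_exp (S.forced_nonneg i) _).const_mul _).add
    (((S.hasGrowth_coord hω i).const_mul _).add ((S.hasGrowth_J hω i).const_mul _))

section Coefficients

variable {S} {ω : PathSpace N} {n i₁ i₂ : ℕ}

/-- The three clauses of (NR) are exactly the rate conditions of `HasGrowth.integrableOn` with `c =
β_n`. -/
theorem integrableOn_exp_mul_mul (hβ : ∀ n, S.m ≤ n → S.β n < 0) (hNR : S.NonResonant)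
    (hn : S.m ≤ n) (h₁ : i₁ < S.m) (h₂ : i₂ < S.m) (hB : S.Bcoef i₁ i₂ n ≠ 0) {f g : ℝ → ℝ}
    (hf : HasGrowth (S.forced i₁) (S.β i₁) f) (hg : HasGrowth (S.forced i₂) (S.β i₂) g) :
    IntegrableOn (fun τ => Real.exp (-S.β n * τ) * f τ * g τ) (Iic 0) := by
  refine hf.integrableOn hg (S.forced_nonneg _) ?_ (fun h => ?_) (fun h => ?_) (hβ n hn)
  · linarith [hNR.1 i₁ h₁ i₂ h₂ n hn hB]
  · linarith [hNR.2.1 i₁ h₁ i₂ h₂ n hn hB (S.σ_ne_zero_of_forced h)]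
  · linarith [hNR.2.2 i₁ h₁ i₂ h₂ n hn hB (S.σ_ne_zero_of_forced h)]

/-- Each kernel is `exp(-β_n τ) f g` with `f` one of `W`, `J`, `exp(β ·)` for mode `i₁` and `g` one
of the same for mode `i₂`. -/
theorem integrableOn_Mkernel (hβ : ∀ n, S.m ≤ n → S.β n < 0) (hNR : S.NonResonant)
    (hω : ω ∈ sublinearPaths N) (hn : S.m ≤ n) (h₁ : i₁ < S.m) (h₂ : i₂ < S.m)
    (hB : S.Bcoef i₁ i₂ n ≠ 0) (j : Fin 8) : IntegrableOn (S.Mkernel ω n i₁ i₂ j) (Iic 0) := by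
  have key : ∀ {f g : ℝ → ℝ}, HasGrowth (S.forced i₁) (S.β i₁) f →
      HasGrowth (S.forced i₂) (S.β i₂) g →
      IntegrableOn (fun τ => Real.exp (-S.β n * τ) * f τ * g τ) (Iic 0) := fun hf hg =>
    integrableOn_exp_mul_mul hβ hNR hn h₁ h₂ hB hf hg
  have W₁ := S.hasGrowth_coord hω i₁
  have W₂ := S.hasGrowth_coord hω i₂
  have J₁ := S.hasGrowth_J hω i₁
  have J₂ := S.hasGrowth_J hω i₂
  have E₁ := hasGrowth_exp (S.forced_nonneg i₁) (S.β i₁)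
  have E₂ := hasGrowth_exp (S.forced_nonneg i₂) (S.β i₂)
  have e : ∀ i τ, Real.exp ((S.β i - S.β n) * τ) =
      Real.exp (-S.β n * τ) * Real.exp (S.β i * τ) := fun i τ => by
    rw [← Real.exp_add]; ring_nf
  fin_cases j
  · exact key W₁ W₂
  · exact key W₁ J₂
  · refine (key J₁ W₂).congr_fun (fun τ _ => ?_) measurableSet_Iic
    simp only [Mkernel]
    exact mul_right_comm _ _ _
  · exact key J₁ J₂
  · refine (key E₁ W₂).congr_fun (fun τ _ => ?_) measurableSet_Iic
    exact congrArg (· * _) (e i₁ τ).symm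
  · refine (key E₁ J₂).congr_fun (fun τ _ => ?_) measurableSet_Iic
    exact congrArg (· * _) (e i₁ τ).symm
  · refine (key W₁ E₂).congr_fun (fun τ _ => ?_) measurableSet_Iic
    exact (mul_right_comm _ _ _).trans (congrArg (· * _) (e i₂ τ).symm)
  · refine (key J₁ E₂).congr_fun (fun τ _ => ?_) measurableSet_Iic
    exact (mul_right_comm _ _ _).trans (congrArg (· * _) (e i₂ τ).symm)

theorem coefD_eq (h : 0 < S.β i₁ + S.β i₂ - S.β n) :
    S.coefD n i₁ i₂ = 1 / (S.β i₁ + S.β i₂ - S.β n) := by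
  rw [coefD, integral_exp_mul_Iic h, mul_zero, Real.exp_zero]

/-- The discounted product of two low-mode coordinates, integrated over the past. -/
theorem integral_exp_mul_lowCoord (hβ : ∀ n, S.m ≤ n → S.β n < 0) (hNR : S.NonResonant)
    (hω : ω ∈ sublinearPaths N) (hn : S.m ≤ n) (h₁ : i₁ < S.m) (h₂ : i₂ < S.m)
    (hB : S.Bcoef i₁ i₂ n ≠ 0) (ξ : H₁) :
    ∫ τ in Iic (0 : ℝ), Real.exp (-S.β n * τ) * S.lowCoord ω ξ i₁ τ * S.lowCoord ω ξ i₂ τ =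
      S.coefA ω n i₁ i₂ + S.coefB ω n i₁ i₂ * S.coeff i₁ (S.ι ξ)
        + S.coefC ω n i₁ i₂ * S.coeff i₂ (S.ι ξ)
        + S.coefD n i₁ i₂ * S.coeff i₁ (S.ι ξ) * S.coeff i₂ (S.ι ξ) := by
  have hM := integrableOn_Mkernel hβ hNR hω hn h₁ h₂ hB
  have hD := integrableOn_exp_mul_Iic (hNR.1 i₁ h₁ i₂ h₂ n hn hB) 0
  set x₁ := S.coeff i₁ (S.ι ξ)
  set x₂ := S.coeff i₂ (S.ι ξ)
  -- Each coordinate has three summands, so the product has nine: the eight kernels, weighted by the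
  -- powers of `ξ` that they carry, and the pure exponential giving `D`.
  set w : Fin 8 → ℝ := ![1, 1, 1, 1, x₁, x₁, x₂, x₂] with hw
  have h : ∀ τ, Real.exp (-S.β n * τ) * S.lowCoord ω ξ i₁ τ * S.lowCoord ω ξ i₂ τ =
      (∑ j, (w j * S.Mfactor i₁ i₂ j) * S.Mkernel ω n i₁ i₂ j τ) +
        x₁ * x₂ * Real.exp ((S.β i₁ + S.β i₂ - S.β n) * τ) := by
    intro τ
    have e : ∀ i, Real.exp ((S.β i - S.β n) * τ) =
        Real.exp (-S.β n * τ) * Real.exp (S.β i * τ) := fun i => by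
      rw [← Real.exp_add]; ring_nf
    have e' : Real.exp ((S.β i₁ + S.β i₂ - S.β n) * τ) =
        Real.exp (-S.β n * τ) * Real.exp (S.β i₁ * τ) * Real.exp (S.β i₂ * τ) := by
      rw [← Real.exp_add, ← Real.exp_add]; ring_nf
    rw [Fin.sum_univ_eight]
    simp only [hw, Mfactor, Mkernel, Matrix.cons_val, e, e', lowCoord]
    ring
  simp only [h]
  rw [integral_add (integrable_finsetSum _ fun j _ => (hM j).const_mul _) (hD.const_mul _),
    integral_finsetSum _ fun j _ => (hM j).const_mul _, integral_const_mul]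
  simp only [integral_const_mul]
  rw [Fin.sum_univ_eight]
  simp only [coefA, coefB, coefC, coefD, M, hw, Matrix.cons_val]
  ring

theorem integrableOn_exp_mul_coord (hβ : ∀ n, S.m ≤ n → S.β n < 0)
    (hω : ω ∈ sublinearPaths N) (hn : S.m ≤ n) :
    IntegrableOn (fun τ => Real.exp (-τ * S.β n) * ω.coord n τ) (Iic 0) := by
  -- The second factor is the constant `exp(0 · τ) = 1`, with `a₂ = 0`; all rate conditions reduce
  -- to `β_n < 0`.
  have h := (BackwardForward.hasGrowth_coord hω n zero_le_one (fun _ => le_rfl) 0).integrableOn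
    (hasGrowth_exp le_rfl 0) zero_le_one (c := S.β n) (by simpa using hβ n hn)
    (fun _ => hβ n hn) (fun h => absurd rfl h) (hβ n hn)
  refine h.congr_fun (fun τ _ => ?_) measurableSet_Iic
  simp only [zero_mul, Real.exp_zero, mul_one]
  rw [neg_mul_comm, mul_comm (S.β n)]

end Coefficients

/-! ### The two integrands -/

theorem Bq_sum (c : ℕ → ℝ) (s : Finset ℕ) :
    S.Bq (∑ k ∈ s, c k • S.e k) =
      ∑ i₁ ∈ s, ∑ i₂ ∈ s, (c i₁ * c i₂) • S.B (S.toAlpha (S.e i₁)) (S.toAlpha (S.e i₂)) := by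
  simp only [Bq, map_sum, map_smul, _root_.sum_apply, _root_.smul_apply,
    Finset.smul_sum, smul_smul]
  rw [Finset.sum_comm]
  refine Finset.sum_congr rfl fun i _ => Finset.sum_congr rfl fun j _ => ?_
  rw [mul_comm]

theorem coeff_Bq_lowPath (ω : PathSpace N) (ξ : H₁) (n : ℕ) (τ : ℝ) :
    S.coeff n (S.Bq (S.lowPath ω ξ τ)) = ∑ i₁ ∈ Finset.range S.m, ∑ i₂ ∈ Finset.range S.m,
      S.lowCoord ω ξ i₁ τ * S.lowCoord ω ξ i₂ τ * S.Bcoef i₁ i₂ n := by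
  rw [lowPath_eq_sum, Bq_sum, coeff_sum]
  refine Finset.sum_congr rfl fun i₁ _ => ?_
  rw [coeff_sum]
  refine Finset.sum_congr rfl fun i₂ _ => ?_
  rw [coeff_smul, Bcoef]

theorem coeff_bilinIntegrand (hβ : ∀ n, S.m ≤ n → S.β n < 0) (ω : PathSpace N) (ξ : H₁) (n : ℕ)
    {τ : ℝ} (hτ : τ ≤ 0) : S.coeff n (S.bilinIntegrand ω ξ τ) =
      if S.m ≤ n then Real.exp (-τ * S.β n) * S.coeff n (S.Bq (S.lowPath ω ξ τ)) else 0 := by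
  rw [bilinIntegrand, S.expLs_spec hβ (by linarith), coeff_Ps]
  split_ifs <;> rfl

theorem coeff_noiseIntegrand (hβ : ∀ n, S.m ≤ n → S.β n < 0) (ω : PathSpace N) (n : ℕ)
    {τ : ℝ} (hτ : τ ≤ 0) : S.coeff n (S.noiseIntegrand ω τ) =
      if S.m ≤ n then S.σ n * S.β n * (Real.exp (-τ * S.β n) * ω.coord n τ) else 0 := by
  rw [noiseIntegrand, S.expLs_spec hβ (by linarith), coeff_Ls_Ps₁, coeff_ι_W]
  split_ifs
  · ring
  · rfl

theorem bilinIntegrand_eq_sum (hβ : ∀ n, S.m ≤ n → S.β n < 0) (ω : PathSpace N) (ξ : H₁)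
    {τ : ℝ} (hτ : τ ≤ 0) : S.bilinIntegrand ω ξ τ =
      ∑ i₁ ∈ Finset.range S.m, ∑ i₂ ∈ Finset.range S.m,
        (S.lowCoord ω ξ i₁ τ * S.lowCoord ω ξ i₂ τ) •
          S.expLs (-τ) (S.Ps (S.B (S.toAlpha (S.e i₁)) (S.toAlpha (S.e i₂)))) := by
  refine S.ext_coeff fun n => ?_
  rw [S.coeff_bilinIntegrand hβ ω ξ n hτ, coeff_Bq_lowPath, coeff_sum]
  simp only [coeff_sum, coeff_smul, S.expLs_spec hβ (neg_nonneg.2 hτ), coeff_Ps]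
  split_ifs with h
  · rw [Finset.mul_sum]
    refine Finset.sum_congr rfl fun i₁ _ => ?_
    rw [Finset.mul_sum]
    refine Finset.sum_congr rfl fun i₂ _ => ?_
    rw [Bcoef]
    ring
  · simp

theorem noiseIntegrand_eq_sum (hβ : ∀ n, S.m ≤ n → S.β n < 0) (ω : PathSpace N)
    {τ : ℝ} (hτ : τ ≤ 0) : S.noiseIntegrand ω τ =
      ∑ n ∈ Finset.Ico S.m N,
        (S.σ n * S.β n * (Real.exp (-τ * S.β n) * ω.coord n τ)) • S.b n := by
  refine S.ext_coeff fun n => ?_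
  rw [S.coeff_noiseIntegrand hβ ω n hτ, coeff_sum_smul_b]
  rcases lt_or_ge n N with h | h
  · simp [h]
  · simp [S.σ_zero n h]

theorem integrableOn_noiseIntegrand (hβ : ∀ n, S.m ≤ n → S.β n < 0) {ω : PathSpace N}
    (hω : ω ∈ sublinearPaths N) : IntegrableOn (S.noiseIntegrand ω) (Iic 0) := by
  have h : IntegrableOn (fun τ => ∑ n ∈ Finset.Ico S.m N,
      (S.σ n * S.β n * (Real.exp (-τ * S.β n) * ω.coord n τ)) • S.b n) (Iic 0) :=
    integrable_finsetSum _ fun n hn => ((integrableOn_exp_mul_coord hβ hω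
      (Finset.mem_Ico.1 hn).1).const_mul _).smul_const _
  exact h.congr_fun (fun τ hτ => (S.noiseIntegrand_eq_sum hβ ω hτ).symm) measurableSet_Iic

theorem integral_noiseIntegrand (hβ : ∀ n, S.m ≤ n → S.β n < 0) {ω : PathSpace N}
    (hω : ω ∈ sublinearPaths N) :
    ∫ τ in Iic (0 : ℝ), S.noiseIntegrand ω τ = ∑ n ∈ Finset.Ico S.m N, S.Z ω n • S.b n := by
  rw [setIntegral_congr_fun measurableSet_Iic fun τ hτ => S.noiseIntegrand_eq_sum hβ ω hτ,
    integral_finsetSum _ fun n hn => ((integrableOn_exp_mul_coord hβ hω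
      (Finset.mem_Ico.1 hn).1).const_mul _).smul_const _]
  refine Finset.sum_congr rfl fun n _ => ?_
  rw [integral_smul_const, integral_const_mul, Z]

/-- Absolute convergence in `H` does not follow coordinatewise from (NR); it requires a single decay
rate for all modes reached by a given pair of low modes. -/
theorem integrableOn_bilinIntegrand (hβ : ∀ n, S.m ≤ n → S.β n < 0) (hNR : S.NonResonant)
    {ω : PathSpace N} (hω : ω ∈ sublinearPaths N) (ξ : H₁) :
    IntegrableOn (S.bilinIntegrand ω ξ) (Iic 0) := by
  have h : IntegrableOn (fun τ => ∑ i₁ ∈ Finset.range S.m, ∑ i₂ ∈ Finset.range S.m,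
        (S.lowCoord ω ξ i₁ τ * S.lowCoord ω ξ i₂ τ) •
          S.expLs (-τ) (S.Ps (S.B (S.toAlpha (S.e i₁)) (S.toAlpha (S.e i₂))))) (Iic 0) := by
    refine integrable_finsetSum _ fun i₁ h₁ => integrable_finsetSum _ fun i₂ h₂ => ?_
    rw [Finset.mem_range] at h₁ h₂
    -- The threshold is the minimum of all bounds imposed on `β_n`; an unforced mode imposes none
    -- and contributes the harmless value `0`. As `β_n → -∞`, the strict bounds leave a uniform gap.
    obtain ⟨c, hc, hcA⟩ := exists_lt_forall_le (S.tendsto_β hβ)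
      (A := {n | S.m ≤ n ∧ S.Bcoef i₁ i₂ n ≠ 0})
      (c := min (min (S.β i₁ + S.β i₂) 0)
        (min (if i₁ < N then S.β i₂ else 0) (if i₂ < N then S.β i₁ else 0))) (by
      rintro n ⟨hn, hB⟩
      refine lt_min (lt_min ?_ (hβ n hn)) (lt_min ?_ ?_)
      · linarith [hNR.1 i₁ h₁ i₂ h₂ n hn hB]
      · split_ifs with hi
        · linarith [hNR.2.1 i₁ h₁ i₂ h₂ n hn hB (S.σ_pos _ hi).ne']
        · exact hβ n hn
      · split_ifs with hi
        · linarith [hNR.2.2 i₁ h₁ i₂ h₂ n hn hB (S.σ_pos _ hi).ne']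
        · exact hβ n hn)
    simp only [lt_min_iff] at hc
    refine (S.hasGrowth_lowCoord hω ξ i₁).integrableOn_smul (S.hasGrowth_lowCoord hω ξ i₂)
      (S.forced_nonneg _) hc.1.1 (fun h => ?_) (fun h => ?_) hc.1.2 ?_ (K := ‖S.Ps (S.B
        (S.toAlpha (S.e i₁)) (S.toAlpha (S.e i₂)))‖) (fun τ hτ => ?_)
    · have hi : i₁ < N := by
        by_contra hi
        exact h (if_neg hi)
      simpa [hi] using hc.2.1
    · have hi : i₂ < N := by
        by_contra hi
        exact h (if_neg hi)
      simpa [hi] using hc.2.2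
    · exact (S.continuousOn_expLs hβ _).comp continuousOn_neg fun τ (hτ : τ ≤ 0) =>
        mem_Ici.2 (neg_nonneg.2 hτ)
    · have := S.norm_expLs_le hβ (neg_nonneg.2 hτ) (x := S.Ps (S.B (S.toAlpha (S.e i₁))
        (S.toAlpha (S.e i₂)))) (c := c) fun n hn hne => hcA n ⟨hn, by
          rw [coeff_Ps, if_pos hn] at hne
          exact hne⟩
      rw [mul_comm]
      convert this using 3
      ring
  exact h.congr_fun (fun τ hτ => (S.bilinIntegrand_eq_sum hβ ω ξ hτ).symm) measurableSet_Iic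

/-! ### The expansion -/

/-- This is the expansion of the Bochner integral in the eigenbasis, since coordinate functionals
commute with the integral. -/
theorem hasSum_expansionTerm (hβ : ∀ n, S.m ≤ n → S.β n < 0) (hNR : S.NonResonant)
    {ω : PathSpace N} (hω : ω ∈ sublinearPaths N) (ξ : H₁) :
    HasSum (fun n => if S.m ≤ n then S.expansionTerm ω ξ n else 0)
      (∫ τ in Iic (0 : ℝ), S.bilinIntegrand ω ξ τ) := by
  have h := S.b.hasSum_repr (∫ τ in Iic (0 : ℝ), S.bilinIntegrand ω ξ τ)
  convert h using 2 with n
  rw [S.b.repr_apply_apply]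
  have h1 := (S.coeffL n).integral_comp_comm (S.integrableOn_bilinIntegrand hβ hNR hω ξ)
  simp only [coeffL_apply] at h1
  change _ = S.coeff n _ • _
  rw [← h1, setIntegral_congr_fun measurableSet_Iic fun τ hτ =>
    S.coeff_bilinIntegrand hβ ω ξ n hτ]
  split_ifs with hn
  swap
  · simp
  have hint : ∀ i₁ ∈ Finset.range S.m, ∀ i₂ ∈ Finset.range S.m, IntegrableOn (fun τ =>
      S.Bcoef i₁ i₂ n * (Real.exp (-S.β n * τ) * S.lowCoord ω ξ i₁ τ * S.lowCoord ω ξ i₂ τ))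
      (Iic 0) := by
    intro i₁ h₁ i₂ h₂
    rcases eq_or_ne (S.Bcoef i₁ i₂ n) 0 with hB | hB
    · simp [hB]
    · exact (integrableOn_exp_mul_mul hβ hNR hn (Finset.mem_range.1 h₁) (Finset.mem_range.1 h₂) hB
        (S.hasGrowth_lowCoord hω ξ i₁) (S.hasGrowth_lowCoord hω ξ i₂)).const_mul _
  have h2 : ∀ τ, Real.exp (-τ * S.β n) * S.coeff n (S.Bq (S.lowPath ω ξ τ)) =
      ∑ i₁ ∈ Finset.range S.m, ∑ i₂ ∈ Finset.range S.m,
      S.Bcoef i₁ i₂ n *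
        (Real.exp (-S.β n * τ) * S.lowCoord ω ξ i₁ τ * S.lowCoord ω ξ i₂ τ) := by
    intro τ
    have e : -τ * S.β n = -S.β n * τ := by ring
    rw [coeff_Bq_lowPath, Finset.mul_sum, e]
    refine Finset.sum_congr rfl fun i₁ _ => ?_
    rw [Finset.mul_sum]
    refine Finset.sum_congr rfl fun i₂ _ => ?_
    ring
  simp only [h2]
  rw [integral_finsetSum _ fun i₁ h₁ => integrable_finsetSum _ fun i₂ h₂ => hint i₁ h₁ i₂ h₂,
    expansionTerm, Finset.sum_smul]
  refine Finset.sum_congr rfl fun i₁ h₁ => ?_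
  rw [integral_finsetSum _ fun i₂ h₂ => hint i₁ h₁ i₂ h₂, Finset.sum_smul]
  refine Finset.sum_congr rfl fun i₂ h₂ => ?_
  rw [integral_const_mul]
  -- Without interaction the integrals in the coefficients may diverge, and their default values are
  -- multiplied by `0`.
  rcases eq_or_ne (S.Bcoef i₁ i₂ n) 0 with hB | hB
  · simp [hB]
  · rw [integral_exp_mul_lowCoord hβ hNR hω hn (Finset.mem_range.1 h₁) (Finset.mem_range.1 h₂) hB,
      mul_comm (S.Bcoef i₁ i₂ n)]

/-! ### The pullback limit -/

/-- The part of the noise which is forgotten in the pullback limit. -/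
def remainder (ω : PathSpace N) (T : ℝ) : H :=
  ∑ n ∈ Finset.Ico S.m N, (S.σ n * (Real.exp (T * S.β n) * ω.coord n (-T))) • S.b n

theorem tendsto_remainder (hβ : ∀ n, S.m ≤ n → S.β n < 0) {ω : PathSpace N}
    (hω : ω ∈ sublinearPaths N) : Tendsto (S.remainder ω) atTop (𝓝 0) := by
  have key : ∀ n ∈ Finset.Ico S.m N,
      Tendsto (fun T : ℝ => (S.σ n * (Real.exp (T * S.β n) * ω.coord n (-T))) • S.b n) atTop
        (𝓝 0) := by
    intro n hn
    have hb := hβ n (Finset.mem_Ico.1 hn).1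
    obtain ⟨C, hC, hCb⟩ := exists_abs_coord_le hω n
    have h1 : Tendsto (fun T : ℝ => C * (Real.exp (T * S.β n) + T * Real.exp (T * S.β n))) atTop
        (𝓝 0) := by
      have e0 : Tendsto (fun T : ℝ => Real.exp (T * S.β n)) atTop (𝓝 0) :=
        Real.tendsto_exp_atBot.comp (tendsto_id.atTop_mul_const_of_neg hb)
      have e1 := (isLittleO_pow_exp_pos_mul_atTop 1 (neg_pos.2 hb)).tendsto_div_nhds_zero
      have e2 : Tendsto (fun T : ℝ => T * Real.exp (T * S.β n)) atTop (𝓝 0) := by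
        refine e1.congr fun T => ?_
        rw [pow_one, div_eq_mul_inv, ← Real.exp_neg]
        ring_nf
      simpa using (e0.add e2).const_mul C
    have h2 : Tendsto (fun T : ℝ => Real.exp (T * S.β n) * ω.coord n (-T)) atTop (𝓝 0) := by
      refine squeeze_zero_norm' ?_ h1
      filter_upwards [eventually_ge_atTop 0] with T hT
      have h3 := hCb (-T) (by linarith)
      rw [abs_neg, abs_of_nonneg hT] at h3
      rw [norm_mul, Real.norm_eq_abs, Real.norm_eq_abs, abs_of_pos (Real.exp_pos _)]
      calc _ ≤ Real.exp (T * S.β n) * (C * (1 + T)) := by gcongr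
        _ = _ := by ring
    simpa using (h2.const_mul (S.σ n)).smul_const (S.b n)
  have h := tendsto_finsetSum _ key
  rw [Finset.sum_const_zero] at h
  exact h

/-- Seen from the fiber `θ_{-T} ω`, the noise differs from `W_τ(ω)` by the constant `W_{-T}`. That
constant contributes `-σ W_{-T}` at the endpoint and `σ W_{-T} (1 - exp(T β))` through the Duhamel
integral, together `-σ exp(T β) W_{-T}`. -/
theorem highPath_lowPath_eq (hβ : ∀ n, S.m ≤ n → S.β n < 0) (hNR : S.NonResonant)
    {ω : PathSpace N} (hω : ω ∈ sublinearPaths N) (ξ : H₁) {T : ℝ} (hT : 0 ≤ T) :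
    S.highPath ω T (S.lowPath ω ξ) T =
      (∫ τ in (-T)..0, S.noiseIntegrand ω τ + S.bilinIntegrand ω ξ τ) - S.remainder ω T := by
  have hlow := S.continuous_lowPath ω ξ
  refine S.ext_coeff fun n => ?_
  have hsub : uIoc (-T) 0 ⊆ Iic 0 := by
    rw [uIoc_of_le (neg_nonpos.2 hT)]
    exact fun τ hτ => hτ.2
  have hint : IntervalIntegrable (fun τ => S.noiseIntegrand ω τ + S.bilinIntegrand ω ξ τ)
      volume (-T) 0 :=
    intervalIntegrable_iff.2 (((S.integrableOn_noiseIntegrand hβ hω).add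
      (S.integrableOn_bilinIntegrand hβ hNR hω ξ)).mono_set hsub)
  have h1 := (S.coeffL n).intervalIntegral_comp_comm hint
  simp only [coeffL_apply] at h1
  rw [coeff_highPath hβ ω T hlow hT, coeff_sub, ← h1, remainder, coeff_sum_smul_b]
  set q : ℝ → ℝ := fun τ => S.coeff n (S.Bq (S.lowPath ω ξ τ)) with hq
  have hqc : Continuous q := (S.coeffL n).continuous.comp (S.continuous_Bq.comp hlow)
  have hWc := ω.continuous_coord n
  have h2 : ∀ τ ∈ uIcc (-T) 0, S.coeff n (S.noiseIntegrand ω τ + S.bilinIntegrand ω ξ τ) =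
      if S.m ≤ n then Real.exp (-τ * S.β n) * (q τ + S.β n * (S.σ n * ω.coord n τ)) else 0 := by
    intro τ hτ
    rw [uIcc_of_le (neg_nonpos.2 hT)] at hτ
    rw [coeff_add, S.coeff_noiseIntegrand hβ ω n hτ.2, S.coeff_bilinIntegrand hβ ω ξ n hτ.2]
    split_ifs <;> ring
  rw [intervalIntegral.integral_congr h2]
  by_cases hn : S.m ≤ n
  swap
  · simp [hn]
  simp only [if_pos hn]
  -- Beyond `N` both sides vanish since `σ_n = 0`, so forced and unforced high modes can be treated
  -- together.
  have h3 : (if n ∈ Finset.Ico S.m N then S.σ n * (Real.exp (T * S.β n) * ω.coord n (-T)) else 0) =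
      S.σ n * (Real.exp (T * S.β n) * ω.coord n (-T)) := by
    rcases lt_or_ge n N with h | h
    · simp [hn, h]
    · simp [S.σ_zero n h]
  have h4 : duhamel (S.β n) (fun r => q (r - T) +
      S.β n * (S.σ n * (shift (-T) ω).coord n r)) T =
      ∫ τ in (-T)..0, (Real.exp (-τ * S.β n) * (q τ + S.β n * (S.σ n * ω.coord n τ)) +
        S.σ n * ω.coord n (-T) * (-S.β n * Real.exp (τ * -S.β n))) := by
    have := intervalIntegral.integral_comp_sub_right (a := 0) (b := T) (fun τ =>
      Real.exp (-τ * S.β n) * (q τ + S.β n * (S.σ n * ω.coord n τ)) +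
        S.σ n * ω.coord n (-T) * (-S.β n * Real.exp (τ * -S.β n))) T
    rw [zero_sub, sub_self] at this
    rw [← this, duhamel]
    refine intervalIntegral.integral_congr fun r _ => ?_
    have e1 : (T - r) * S.β n = -(r - T) * S.β n := by ring
    have e2 : (r - T) * -S.β n = -(r - T) * S.β n := by ring
    rw [coord_shift_neg, e1, e2]
    ring
  -- This evaluates `∫_{-T}^0 -β exp(-β τ) dτ = 1 - exp(T β)`.
  have h5 := exp_mul_eq_integral (-S.β n) (-T)
  rw [intervalIntegral.integral_symm, neg_mul_neg] at h5
  rw [h3, h4, intervalIntegral.integral_add (Continuous.intervalIntegrable (by fun_prop) _ _)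
    (Continuous.intervalIntegrable (by fun_prop) _ _),
    intervalIntegral.integral_const_mul (S.σ n * ω.coord n (-T)), coord_shift_neg, sub_self,
    PathSpace.coord_zero, h5]
  ring

theorem tendsto_highPath_lowPath (hβ : ∀ n, S.m ≤ n → S.β n < 0) (hNR : S.NonResonant)
    {ω : PathSpace N} (hω : ω ∈ sublinearPaths N) (ξ : H₁) :
    Tendsto (fun T => S.highPath ω T (S.lowPath ω ξ) T) atTop
      (𝓝 ((∫ τ in Iic (0 : ℝ), S.noiseIntegrand ω τ) +
        ∫ τ in Iic (0 : ℝ), S.bilinIntegrand ω ξ τ)) := by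
  have hN := S.integrableOn_noiseIntegrand hβ hω
  have hB := S.integrableOn_bilinIntegrand hβ hNR hω ξ
  have h1 := (intervalIntegral_tendsto_integral_Iic 0 (hN.add hB)
    tendsto_neg_atTop_atBot).sub (S.tendsto_remainder hβ hω)
  rw [sub_zero] at h1
  have h2 := integral_add hN hB
  simp only [Pi.add_apply] at h1
  rw [h2] at h1
  refine h1.congr' ?_
  filter_upwards [eventually_ge_atTop 0] with T hT
  rw [S.highPath_lowPath_eq hβ hNR hω ξ hT]

theorem IsSolution.eq_highPath {S : Setting H H₁ Hα N} (hβ : ∀ n, S.m ≤ n → S.β n < 0)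
    {ω : PathSpace N} {ξ : H₁} (hξ : ξ ∈ S.Hc) {T : ℝ} (hT : 0 ≤ T) {uc : ℝ → H₁} {us : ℝ → H}
    (h : S.IsSolution ω ξ T uc us) : us T = S.highPath ω T (S.lowPath ω ξ) T :=
  IsHighSolution.eqOn (S.continuous_lowPath ω ξ)
    (h.high.congr (h.low.eqOn hT (S.isLowSolution_lowPath ω hξ T)))
    (isHighSolution_highPath hβ ω T (S.continuous_lowPath ω ξ)) ⟨hT, le_rfl⟩

end Setting

end BackwardForward

end

/-! ### Assembly of the theorem. -/

theorem mainTheorem1 {H H₁ Hα : Type*}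
    [NormedAddCommGroup H] [InnerProductSpace ℝ H] [CompleteSpace H]
    [NormedAddCommGroup H₁] [InnerProductSpace ℝ H₁] [CompleteSpace H₁]
    [NormedAddCommGroup Hα] [NormedSpace ℝ Hα] {N : ℕ}
    (S : BackwardForward.Setting H H₁ Hα N)
    (P : Measure (BackwardForward.PathSpace N)) (hP : BackwardForward.IsWienerMeasure P)
    (hβ : ∀ n, S.m ≤ n → S.β n < 0)
    (hNR : S.NonResonant) :
    -- the set of admissible paths has full measure and is invariant
    (∀ᵐ ω ∂P, ω ∈ BackwardForward.sublinearPaths N) ∧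
    (∀ t : ℝ, BackwardForward.shift t ⁻¹' BackwardForward.sublinearPaths N =
      BackwardForward.sublinearPaths N) ∧
    ∀ ω ∈ BackwardForward.sublinearPaths N,
      -- the coefficients exist
      (∀ n, S.m ≤ n → n < N →
        IntegrableOn (fun τ => Real.exp (-τ * S.β n) * ω.coord n τ) (Iic 0)) ∧
      (∀ n, S.m ≤ n → ∀ i₁ < S.m, ∀ i₂ < S.m, S.Bcoef i₁ i₂ n ≠ 0 →
        (∀ j, IntegrableOn (S.Mkernel ω n i₁ i₂ j) (Iic 0)) ∧
        IntegrableOn (fun τ => Real.exp ((S.β i₁ + S.β i₂ - S.β n) * τ)) (Iic 0) ∧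
        S.coefD n i₁ i₂ = 1 / (S.β i₁ + S.β i₂ - S.β n)) ∧
      ∀ ξ ∈ S.Hc,
        -- the low-mode equation is uniquely solvable, by the explicit path
        (∀ T : ℝ, 0 < T → S.IsLowSolution ω ξ T (S.lowPath ω ξ) ∧
          ∀ u, S.IsLowSolution ω ξ T u → EqOn u (S.lowPath ω ξ) (Icc (-T) 0)) ∧
        -- the high-mode equation is uniquely solvable
        (∀ T : ℝ, 0 < T → ∃ us, S.IsHighSolution ω T (S.lowPath ω ξ) us ∧
          ∀ u, S.IsHighSolution ω T (S.lowPath ω ξ) u → EqOn u us (Icc 0 T)) ∧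
        -- both integrals over `(-∞, 0]` converge in `H`
        IntegrableOn (S.noiseIntegrand ω) (Iic 0) ∧
        IntegrableOn (S.bilinIntegrand ω ξ) (Iic 0) ∧
        -- the pullback limit, its integral form and its expansion
        ∃ h : H,
          (∀ (uc : ℝ → ℝ → H₁) (us : ℝ → ℝ → H),
            (∀ T : ℝ, 0 < T → S.IsSolution ω ξ T (uc T) (us T)) →
            Tendsto (fun T => us T T) atTop (𝓝 h)) ∧
          h = (∫ τ in Iic (0 : ℝ), S.noiseIntegrand ω τ) +
              (∫ τ in Iic (0 : ℝ), S.bilinIntegrand ω ξ τ) ∧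
          HasSum (fun n => if S.m ≤ n then S.expansionTerm ω ξ n else 0)
            (h - ∑ n ∈ Finset.Ico S.m N, S.Z ω n • S.b n) := by
  refine ⟨BackwardForward.ae_mem_sublinearPaths hP,
    fun t => BackwardForward.shift_preimage_sublinearPaths t, fun ω hω =>
    ⟨fun n hn _ => S.integrableOn_exp_mul_coord hβ hω hn,
    fun n hn i₁ h₁ i₂ h₂ hB => ⟨S.integrableOn_Mkernel hβ hNR hω hn h₁ h₂ hB, ?_,
      S.coefD_eq (hNR.1 i₁ h₁ i₂ h₂ n hn hB)⟩, fun ξ hξ => ⟨fun T hT => ?_, fun T hT => ?_,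
      S.integrableOn_noiseIntegrand hβ hω, S.integrableOn_bilinIntegrand hβ hNR hω ξ,
      (∫ τ in Iic (0 : ℝ), S.noiseIntegrand ω τ) + ∫ τ in Iic (0 : ℝ), S.bilinIntegrand ω ξ τ,
      fun uc us hsol => ?_, rfl, ?_⟩⟩⟩
  · exact integrableOn_exp_mul_Iic (hNR.1 i₁ h₁ i₂ h₂ n hn hB) 0
  · exact ⟨S.isLowSolution_lowPath ω hξ T, fun u hu =>
      hu.eqOn hT.le (S.isLowSolution_lowPath ω hξ T)⟩
  · have h := BackwardForward.Setting.isHighSolution_highPath hβ ω T (S.continuous_lowPath ω ξ)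
    exact ⟨_, h, fun u hu => hu.eqOn (S.continuous_lowPath ω ξ) h⟩
  -- The solutions are arbitrary for each horizon, but uniqueness fixes their terminal value for
  -- every `T > 0`.
  · refine (S.tendsto_highPath_lowPath hβ hNR hω ξ).congr' ?_
    filter_upwards [eventually_gt_atTop 0] with T hT
    exact ((hsol T hT).eq_highPath hβ hξ hT.le).symm
  · rw [S.integral_noiseIntegrand hβ hω, add_sub_cancel_left]
    exact S.hasSum_expansionTerm hβ hNR hω ξ
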